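/- Setting. A Bernstein function is a function $\Phi\in C^\infty(0,\infty)$ with $\Phi\ge 0$ and $(-1)^n\Phi^{(n)}\le 0$ for all $n\ge 1$; it is special if $\Phi>0$ and $\lambda\mapsto\lambda/\Phi(\lambda)$ is also a Bernstein function. Let $\Phi$ be a special Bernstein function of the form $\Phi(\lambda)=\int_{(0,\infty)}(1-e^{-\lambda x})\,\nu(dx)$ for all $\lambda>0$, where $\nu$ is a measure on $(0,\infty)$ with $\int(1\wedge x)\,\nu(dx)<\infty$ and $\nu(0,\infty)=\infty$, and put $\bar\nu(t)=\nu(t,\infty)$. Let $\sigma$ be the subordinator (non-decreasing Lévy process) with $\mathbb E[e^{-\lambda\sigma(t)}]=e^{-t\Phi(\lambda)}$, and let $u$ be its potential density, i.e. the non-negative non-increasing function on $(0,\infty)$ with $\mathbb E\big[\int_0^\infty \mathbf 1_A(\sigma(s))\,ds\big]=\int_A u(t)\,dt$ for all Borel $A\subseteq[0,\infty)$. Assume that there are $t_0>0$, $C>0$ and $\beta\in(0,1)$ such that $u(t)\le Ct^{\beta-1}$ for all $t\in(0,t_0)$. Let $(X,|\cdot|)$ be a Banach space, $(V,d)$ a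 locally compact metric space, $T>0$, $J=[0,T]$, and let $F:J\times X\times V\to X$ be such that $t\mapsto F(t,x;v)$ is strongly measurable for all $x\in X$, $v\in V$. Write $B_r=\{x\in X:|x|<r\}$ and $B_r(f_0)=\{x\in X:|x-f_0|<r\}$. Assume that for every compact $K\subseteq V$ and every $r>0$ there are positive constants $C_{r,K},L_{r,K},\widetilde L_{r,K}$ such that for almost every $t\in J$: * (A1′) $|F(t,x;v)|\le C_{r,K}$ for all $x\in B_r$, $v\in K$; * (A2′) $|F(t,x;v)-F(t,z;v)|\le L_{r,K}|x-z|$ for all $x,z\in B_r$, $v\in K$; * (A3′) $|F(t,x;v_1)-F(t,x;v_2)|\le\widetilde L_{r,K}\,d(v_1,v_2)$ for all $x\in B_r$, $v_1,v_2\in K$. For $f_0\in X$, $v\in V$ and $T'\in(0,T]$, a solution on $[0,T']$ of $$\partial_t^\Phi f(t)=F(t,f(t);v)\ \text{ for a.e. } t\in[0,T'],\qquad f(0)=f_0 \tag{$P_v$}$$ is a function $f\in C([0,T'],X)$ with $f(0)=f_0$ such that $t\mapsto\int_0^t\bar\nu(t-s)(f(s)-f(0))\,ds$ is absolutely continuous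 on $[0,T']$ and its derivative $\partial_t^\Phi f(t)$ exists and equals $F(t,f(t);v)$ for almost every $t\in[0,T']$. Proposition. Fix $f_0\in X$, $v_0\in V$ and $R>0$. 1. There are $T'\in(0,T]$ and a compact neighbourhood $K$ of $v_0$ such that for every $v\in K$ problem $(P_v)$ has exactly one solution on $[0,T']$ with values in $B_R(f_0)$. 2. Let $T'\in(0,T]$, let $K$ be a compact neighbourhood of $v_0$, and suppose that for every $v\in K$ the function $\Psi(\cdot;v)\in C([0,T'],X)$ is a solution of $(P_v)$ on $[0,T']$ with values in $B_R(f_0)$. Then the map $K\to C([0,T'],X)$, $v\mapsto\Psi(\cdot;v)$ (with the supremum norm), is continuous at $v_0$; indeed it is Lipschitz continuous on $K$. -/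

import Mathlib

open MeasureTheory ProbabilityTheory Set Filter Topology
open scoped NNReal ENNReal

noncomputable section

/-- Bernstein functions on `(0, ∞)` (values of `Φ` outside `(0, ∞)` are irrelevant). -/
structure IsBernstein (Φ : ℝ → ℝ) : Prop where
  contDiffOn : ContDiffOn ℝ (⊤ : ℕ∞) Φ (Ioi 0)
  nonneg : ∀ l : ℝ, 0 < l → 0 ≤ Φ l
  alternating : ∀ n : ℕ, 1 ≤ n → ∀ l : ℝ, 0 < l → (-1 : ℝ) ^ n * iteratedDeriv n Φ l ≤ 0

/-- Special Bernstein functions: `Φ` is Bernstein, does not vanish on `(0, ∞)`, and its conjugate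
`l ↦ l / Φ l` is Bernstein. -/
structure IsSpecialBernstein (Φ : ℝ → ℝ) : Prop where
  isBernstein : IsBernstein Φ
  pos : ∀ l : ℝ, 0 < l → 0 < Φ l
  conjugate : IsBernstein (fun l => l / Φ l)

/-- `(a, b, ν)` is the Lévy triple of `Φ`: `ν` is a measure on `(0, ∞)` with
`∫ (1 ∧ x) ν(dx) < ∞` and `Φ l = a + b l + ∫ (1 - e^{-l x}) ν(dx)` for all `l > 0`. -/
structure HasLevyTriple (Φ : ℝ → ℝ) (a b : ℝ) (ν : Measure ℝ) : Prop where
  drift_nonneg : 0 ≤ a ∧ 0 ≤ b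
  support : ν (Iic 0) = 0
  integrable_min : ∫⁻ x in Ioi (0 : ℝ), ENNReal.ofReal (min 1 x) ∂ν < ∞
  repr : ∀ l : ℝ, 0 < l →
    Φ l = a + b * l + ∫ x in Ioi (0 : ℝ), (1 - Real.exp (-(l * x))) ∂ν

/-- A subordinator: a real-valued Lévy process (started at `0`, independent and stationary
increments, almost surely càdlàg paths) with almost surely non-decreasing paths. -/
structure IsSubordinator {Ω : Type*} [MeasurableSpace Ω] (σ : ℝ≥0 → Ω → ℝ) (P : Measure Ω) :
    Prop where
  measurable : ∀ t, Measurable (σ t)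
  zero : ∀ᵐ ω ∂P, σ 0 ω = 0
  indep : HasIndepIncrements σ P
  stationary : ∀ s t : ℝ≥0, IdentDistrib (fun ω => σ (s + t) ω - σ s ω) (σ t) P P
  right_continuous : ∀ᵐ ω ∂P, ∀ t : ℝ≥0, ContinuousWithinAt (fun s => σ s ω) (Ici t) t
  left_limits : ∀ᵐ ω ∂P, ∀ t : ℝ≥0, ∃ l : ℝ, Tendsto (fun s => σ s ω) (𝓝[<] t) (𝓝 l)
  monotone : ∀ᵐ ω ∂P, Monotone (fun s => σ s ω)

/-- `Φ` is the Laplace exponent of `σ`: `E[e^{-l σ(t)}] = e^{-t Φ(l)}`. -/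
def HasLaplaceExponent {Ω : Type*} [MeasurableSpace Ω] (σ : ℝ≥0 → Ω → ℝ) (P : Measure Ω)
    (Φ : ℝ → ℝ) : Prop :=
  ∀ (t : ℝ≥0) (l : ℝ), 0 < l →
    ∫ ω, Real.exp (-(l * σ t ω)) ∂P = Real.exp (-((t : ℝ) * Φ l))

/-- The potential (occupation) measure `U(A) = E[∫_0^∞ 1_A(σ(s)) ds]`. -/
def potential {Ω : Type*} [MeasurableSpace Ω] (σ : ℝ≥0 → Ω → ℝ) (P : Measure Ω)
    (A : Set ℝ) : ℝ≥0∞ :=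
  ∫⁻ ω, (∫⁻ s in Ici (0 : ℝ), A.indicator 1 (σ s.toNNReal ω) ∂volume) ∂P

/-- `u` is the non-negative, non-increasing potential density on `(0, ∞)`:
`U(A) = ∫_A u(t) dt` for all Borel `A ⊆ [0, ∞)`. -/
structure IsPotentialDensity {Ω : Type*} [MeasurableSpace Ω] (σ : ℝ≥0 → Ω → ℝ) (P : Measure Ω)
    (u : ℝ → ℝ) : Prop where
  nonneg : ∀ t : ℝ, 0 < t → 0 ≤ u t
  antitone : AntitoneOn u (Ioi 0)
  density : ∀ A : Set ℝ, MeasurableSet A → A ⊆ Ici 0 →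
    potential σ P A = ∫⁻ t in A, ENNReal.ofReal (u t)

/-- The convolution `∫_0^t ν(t - s, ∞) (f(s) - f(0)) ds`, whose derivative in `t` is the
generalized Caputo derivative of `f`. -/
def caputoPrimitive {X : Type*} [NormedAddCommGroup X] [NormedSpace ℝ X] (ν : Measure ℝ)
    (f : ℝ → X) (t : ℝ) : X :=
  ∫ s in (0 : ℝ)..t, (ν (Ioi (t - s))).toReal • (f s - f 0)

/-- The generalized Caputo derivative of `f` at `t` exists and equals `d`. -/
def HasCaputoDerivAt {X : Type*} [NormedAddCommGroup X] [NormedSpace ℝ X] (ν : Measure ℝ)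
    (f : ℝ → X) (d : X) (t : ℝ) : Prop :=
  HasDerivAt (caputoPrimitive ν f) d t

/-- `f ∈ C([0, T'], X)` solves the Cauchy problem `∂^Φ f(t) = G(t, f(t))` for a.e. `t ∈ [0, T']`,
`f(0) = f₀`. The generalized Caputo derivative being defined on `[0, T']` includes the absolute
continuity of the convolution that is differentiated. The constant extension of `f` beyond the
end points only serves to write `f` as a function on `ℝ`; for `0 < t < T'` the derivative does not
depend on it. -/
structure IsCauchySolution {X : Type*} [NormedAddCommGroup X] [NormedSpace ℝ X] (ν : Measure ℝ)
    (G : ℝ → X → X) (f₀ : X) {T' : ℝ} (hT' : 0 ≤ T') (f : C(Icc (0 : ℝ) T', X)) : Prop where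
  initial : f ⟨0, left_mem_Icc.2 hT'⟩ = f₀
  absolutelyContinuous :
    AbsolutelyContinuousOnInterval (caputoPrimitive ν (IccExtend hT' f)) 0 T'
  equation : ∀ᵐ t ∂(volume.restrict (Icc (0 : ℝ) T')),
    HasCaputoDerivAt ν (IccExtend hT' f) (G t (IccExtend hT' f t)) t

end

/-! The Cauchy problem is the Volterra equation f = f₀ + u * F(·, f; v) in disguise, and that
equation yields to a fixed-point argument.

The link is the Sonine relation u * ν̄ = 1. The Laplace transform of u is 1/Φ(l) and that of ν̄ is
Φ(l)/l; their product 1/l is the transform of the constant 1, and transforms determine functions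
almost everywhere (`HasLaplaceInv.ae_eq`, `IsPotentialDensity.isSoninePair`). By Fubini, convolving
with ν̄ and then with u, in either order, is integration from 0 (`volterra_volterra`). Write g(t) =
F(t, f(t); v). If ν̄ * (f - f₀) is absolutely continuous with derivative g, it equals ∫g = ν̄ * (u *
g); convolving the difference with u gives f - f₀ = u * g by continuity. Conversely, f - f₀ = u * g
gives ν̄ * (f - f₀) = ∫g (`isCauchySolution_iff`).

Since u is integrable near 0, ∫_0^{T'} u is small for small T', and the Volterra map contracts a
closed ball (`exists_volterra_eq`). On an arbitrary interval the weight e^{-ct} with large c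
replaces smallness of T'; comparing two equations in the weighted norm gives both uniqueness and
Lipschitz dependence on v (`dist_le_of_volterra_eq`). -/

/-! ### Laplace transforms and uniqueness for 1/l -/

theorem measurable_indicator_of_antitoneOn {f : ℝ → ℝ≥0∞} (hf : AntitoneOn f (Ioi 0)) :
    Measurable ((Ioi (0 : ℝ)).indicator f) := by
  refine measurable_of_Ioi fun c => ?_
  have h : OrdConnected {x : ℝ | 0 < x ∧ c < f x} := by
    refine ordConnected_of_Ioo ?_
    rintro x ⟨hx, -⟩ y ⟨hy, hcy⟩ - z ⟨hz, hz'⟩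
    exact ⟨hx.trans hz, hcy.trans_le (hf (hx.trans hz) hy hz'.le)⟩
  convert! h.measurableSet using 1
  ext x
  by_cases hx : 0 < x <;> simp [hx]

/-- The Laplace transform of a function on `ℝ` with values in `[0, ∞]`. -/
noncomputable def laplaceTransform (f : ℝ → ℝ≥0∞) (l : ℝ) : ℝ≥0∞ :=
  ∫⁻ t, ENNReal.ofReal (Real.exp (-(l * t))) * f t

theorem laplaceTransform_lconvolution {f g : ℝ → ℝ≥0∞} (hf : Measurable f) (hg : Measurable g)
    (l : ℝ) :
    laplaceTransform (f ⋆ₗ g) l = laplaceTransform f l * laplaceTransform g l := by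
  unfold laplaceTransform
  simp only [lconvolution_def]
  calc ∫⁻ t, ENNReal.ofReal (Real.exp (-(l * t))) * ∫⁻ y, f y * g (-y + t)
      = ∫⁻ t, ∫⁻ y, ENNReal.ofReal (Real.exp (-(l * t))) * (f y * g (-y + t)) := by
        refine lintegral_congr fun t => ?_
        rw [lintegral_const_mul _ (by fun_prop)]
    _ = ∫⁻ y, ∫⁻ t, ENNReal.ofReal (Real.exp (-(l * t))) * (f y * g (-y + t)) :=
        lintegral_lintegral_swap (by fun_prop)
    _ = ∫⁻ y, (ENNReal.ofReal (Real.exp (-(l * y))) * f y) *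
          ∫⁻ t, ENNReal.ofReal (Real.exp (-(l * t))) * g t := by
        refine lintegral_congr fun y => ?_
        rw [← lintegral_const_mul _ (by fun_prop), ← lintegral_add_left_eq_self _ y]
        refine lintegral_congr fun t => ?_
        rw [neg_add_cancel_left, show -(l * (y + t)) = -(l * y) + -(l * t) by ring, Real.exp_add,
          ENNReal.ofReal_mul (Real.exp_nonneg _)]
        ring
    _ = _ := lintegral_mul_const _ (by fun_prop)

/-- The measure with density `e^{-t} f(t)`. -/
noncomputable def expTilt (f : ℝ → ℝ≥0∞) : Measure ℝ :=
  volume.withDensity fun t => ENNReal.ofReal (Real.exp (-t)) * f t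

/-- Tilting shifts the half-line l > 0 to s < 1, a neighbourhood of 0, so that the theory of moment
generating functions of finite measures applies. -/
theorem lintegral_exp_expTilt {f : ℝ → ℝ≥0∞} (hf : Measurable f) (s : ℝ) :
    ∫⁻ t, ENNReal.ofReal (Real.exp (s * t)) ∂(expTilt f) = laplaceTransform f (1 - s) := by
  rw [expTilt, lintegral_withDensity_eq_lintegral_mul _ (by fun_prop) (by fun_prop)]
  refine lintegral_congr fun t => ?_
  rw [Pi.mul_apply, show -((1 - s) * t) = -t + s * t by ring, Real.exp_add,
    ENNReal.ofReal_mul (Real.exp_nonneg _)]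
  ring

theorem laplaceTransform_le_of_le {f : ℝ → ℝ≥0∞} (hf0 : ∀ t ≤ 0, f t = 0) {l m : ℝ}
    (h : l ≤ m) : laplaceTransform f m ≤ laplaceTransform f l := by
  refine lintegral_mono fun t => ?_
  rcases le_or_gt t 0 with ht | ht
  · simp [hf0 t ht]
  · dsimp only
    gcongr

/-- Functions on `(0, ∞)` whose Laplace transform is `1 / l`. -/
structure HasLaplaceInv (f : ℝ → ℝ≥0∞) : Prop where
  measurable : Measurable f
  zero : ∀ t ≤ 0, f t = 0
  laplace : ∀ l : ℝ, 0 < l → laplaceTransform f l = ENNReal.ofReal l⁻¹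

namespace HasLaplaceInv

variable {f g : ℝ → ℝ≥0∞}

/-- By monotonicity the transform at l ≤ 0 dominates 1/m for every m > 0. This determines the
integrability set of the tilted measure exactly. -/
theorem laplace_eq_top (hf : HasLaplaceInv f) {l : ℝ} (hl : l ≤ 0) :
    laplaceTransform f l = ∞ := by
  refine ENNReal.eq_top_of_forall_nnreal_le fun r => ?_
  refine le_trans ?_ (laplaceTransform_le_of_le hf.zero (m := (r + 1 : ℝ)⁻¹) (hl.trans (by positivity)))
  rw [hf.laplace _ (by positivity), inv_inv]
  rw [← ENNReal.ofReal_coe_nnreal]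
  exact ENNReal.ofReal_le_ofReal (by linarith)

theorem isFiniteMeasure (hf : HasLaplaceInv f) : IsFiniteMeasure (expTilt f) := by
  constructor
  have := lintegral_exp_expTilt hf.measurable 0
  simp only [zero_mul, Real.exp_zero, ENNReal.ofReal_one, lintegral_one, sub_zero,
    hf.laplace 1 one_pos] at this
  rw [this]
  exact ENNReal.ofReal_lt_top

theorem integrable_exp_iff (hf : HasLaplaceInv f) (s : ℝ) :
    Integrable (fun x => Real.exp (s * x)) (expTilt f) ↔ s < 1 := by
  rw [← lintegral_ofReal_ne_top_iff_integrable (by fun_prop)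
    (Eventually.of_forall fun _ => Real.exp_nonneg _), lintegral_exp_expTilt hf.measurable]
  rcases lt_or_ge s 1 with hs | hs
  · simp [hf.laplace (1 - s) (by linarith), hs]
  · simp [hf.laplace_eq_top (l := 1 - s) (by linarith), hs]

theorem mgf_expTilt (hf : HasLaplaceInv f) (s : ℝ) :
    mgf id (expTilt f) s = if s < 1 then (1 - s)⁻¹ else 0 := by
  split_ifs with hs
  · rw [mgf, integral_eq_lintegral_of_nonneg_ae (Eventually.of_forall fun _ => Real.exp_nonneg _)
      (by fun_prop)]
    simp only [id_eq]
    rw [lintegral_exp_expTilt hf.measurable, hf.laplace _ (by linarith),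
      ENNReal.toReal_ofReal (by rw [inv_nonneg]; linarith)]
  -- The value 0 for s ≥ 1 is the default of a divergent Bochner integral; it lets two generating
  -- functions agree on all of ℝ.
  · exact integral_undef fun h => hs ((hf.integrable_exp_iff s).1 h)

theorem expTilt_ne_zero (hf : HasLaplaceInv f) : expTilt f ≠ 0 := by
  intro h
  have := hf.mgf_expTilt 0
  simp [h] at this

/-- Uniqueness of the inverse Laplace transform, for the function `l ↦ 1 / l`. -/
theorem ae_eq (hf : HasLaplaceInv f) (hg : HasLaplaceInv g) : f =ᵐ[volume] g := by
  have := hf.isFiniteMeasure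
  have := hg.isFiniteMeasure
  have key : expTilt f = expTilt g := by
    -- Equal real generating functions have equal analytic extensions to Re z < 1. This region
    -- contains the imaginary axis, so the characteristic functions agree.
    have h := eqOn_complexMGF_of_mgf' (X := id) (Y := id) (μ := expTilt f) (μ' := expTilt g)
      (by ext s; rw [hf.mgf_expTilt, hg.mgf_expTilt])
      (by simp [hf.expTilt_ne_zero, hg.expTilt_ne_zero])
    refine Measure.ext_of_charFun (funext fun t => ?_)
    rw [← complexMGF_id_mul_I, ← complexMGF_id_mul_I]
    refine h ?_
    have hset : integrableExpSet id (expTilt f) = Iio 1 := by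
      ext s
      exact hf.integrable_exp_iff s
    simp [hset]
  have hfm := hf.measurable
  have hgm := hg.measurable
  have h2 := (withDensity_eq_iff (by fun_prop) (by fun_prop) ?_).1 key
  · filter_upwards [h2] with t ht
    exact (ENNReal.mul_right_inj (by simp [Real.exp_pos]) ENNReal.ofReal_ne_top).1 ht
  · have := hf.laplace 1 one_pos
    simp only [laplaceTransform, one_mul] at this
    simp [this]

end HasLaplaceInv

theorem hasLaplaceInv_indicator_one : HasLaplaceInv ((Ioi (0 : ℝ)).indicator 1) where
  measurable := measurable_one.indicator measurableSet_Ioi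
  zero t ht := by simp [ht]
  laplace l hl := by
    have : laplaceTransform ((Ioi (0 : ℝ)).indicator 1) l =
        ∫⁻ t in Ioi (0 : ℝ), ENNReal.ofReal (Real.exp (-l * t)) := by
      rw [laplaceTransform, ← lintegral_indicator measurableSet_Ioi]
      refine lintegral_congr fun t => ?_
      by_cases ht : t ∈ Ioi (0 : ℝ) <;> simp [ht, -mem_Ioi]
    rw [this, ← ofReal_integral_eq_lintegral_ofReal]
    · rw [integral_exp_mul_Ioi (by linarith)]
      simp
    · exact integrableOn_exp_mul_Ioi (by linarith) 0
    · exact Eventually.of_forall fun _ => Real.exp_nonneg _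

/-! ### The potential density and its Laplace transform -/

section Potential

variable {Ω : Type*} [MeasurableSpace Ω] {P : Measure Ω}
  {σ : ℝ≥0 → Ω → ℝ} {Φ u : ℝ → ℝ}

theorem IsSubordinator.ae_nonneg (hσ : IsSubordinator σ P) : ∀ᵐ ω ∂P, ∀ t, 0 ≤ σ t ω := by
  filter_upwards [hσ.zero, hσ.monotone] with ω h0 hm t
  exact h0 ▸ hm (zero_le : 0 ≤ t)

/-- The grid point is taken to the right of t because the paths are only right-continuous. -/
theorem tendsto_floor_add_one_div (t : ℝ≥0) :
    Tendsto (fun n : ℕ => ((⌊(n : ℝ≥0) * t⌋₊ + 1 : ℝ≥0) / n : ℝ≥0)) atTop (𝓝[≥] t) := by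
  refine tendsto_nhdsWithin_iff.2 ⟨?_, ?_⟩
  · have h1 : Tendsto (fun n : ℕ => (t + 1 / n : ℝ≥0)) atTop (𝓝 t) := by
      simpa using tendsto_const_nhds.add (tendsto_one_div_atTop_nhds_zero_nat (𝕜 := ℝ≥0))
    refine tendsto_of_tendsto_of_tendsto_of_le_of_le' tendsto_const_nhds h1 ?_ ?_
    · filter_upwards [eventually_gt_atTop 0] with n hn
      rw [le_div_iff₀ (by exact_mod_cast hn), mul_comm]
      exact (Nat.lt_floor_add_one _).le
    · filter_upwards [eventually_gt_atTop 0] with n hn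
      have hn' : (0 : ℝ≥0) < n := by exact_mod_cast hn
      rw [div_le_iff₀ hn', add_mul, one_div, inv_mul_cancel₀ hn'.ne', mul_comm t]
      gcongr
      exact Nat.floor_le zero_le
  · filter_upwards [eventually_gt_atTop 0] with n hn
    rw [mem_Ici, le_div_iff₀ (by exact_mod_cast hn), mul_comm]
    exact (Nat.lt_floor_add_one _).le

/-- Sampling time on a grid leaves countably many random variables, hence a jointly measurable map.
The samples converge wherever the path is right-continuous, that is, almost surely. -/
theorem IsSubordinator.aemeasurable_uncurry (hσ : IsSubordinator σ P) (m : Measure ℝ) [SFinite m] :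
    AEMeasurable (fun p : Ω × ℝ => σ p.2.toNNReal p.1) (P.prod m) := by
  refine aemeasurable_of_tendsto_metrizable_ae atTop
    (f := fun (n : ℕ) (p : Ω × ℝ) =>
      σ ((⌊(n : ℝ≥0) * p.2.toNNReal⌋₊ + 1 : ℝ≥0) / n) p.1) (fun n => ?_) ?_
  · have h1 : Measurable fun q : Ω × ℕ => σ ((q.2 + 1 : ℝ≥0) / n) q.1 :=
      measurable_from_prod_countable_left fun k => hσ.measurable ((k + 1 : ℝ≥0) / n)
    have h2 : Measurable fun p : Ω × ℝ => (p.1, ⌊(n : ℝ≥0) * p.2.toNNReal⌋₊) := by fun_prop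
    exact (h1.comp h2).aemeasurable
  · have h := Measure.quasiMeasurePreserving_fst (μ := P) (ν := m) |>.ae hσ.right_continuous
    filter_upwards [h] with p hp
    exact (hp _).tendsto.comp (tendsto_floor_add_one_div _)

/-- The potential measure is the image of the product measure under the process. -/
theorem IsSubordinator.potential_eq_map (hσ : IsSubordinator σ P) {A : Set ℝ}
    (hA : MeasurableSet A) :
    potential σ P A = ((P.prod (volume.restrict (Ici (0 : ℝ)))).map
      fun p : Ω × ℝ => σ p.2.toNNReal p.1) A := by
  have hm := hσ.aemeasurable_uncurry (volume.restrict (Ici (0 : ℝ)))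
  rw [← lintegral_indicator_one hA, lintegral_map' (measurable_one.indicator hA).aemeasurable hm,
    lintegral_prod _ (by exact (measurable_one.indicator hA).comp_aemeasurable hm)]
  rfl

/-- The density is prescribed only on Borel subsets of [0, ∞). Almost surely σ ≥ 0, so the negative
half-line carries no mass, and the point 0 is Lebesgue-null. -/
theorem IsSubordinator.potential_measure_eq (hσ : IsSubordinator σ P)
    (hu : IsPotentialDensity σ P u) :
    (P.prod (volume.restrict (Ici (0 : ℝ)))).map (fun p : Ω × ℝ => σ p.2.toNNReal p.1) =
      volume.withDensity ((Ioi (0 : ℝ)).indicator fun t => ENNReal.ofReal (u t)) := by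
  have hm := hσ.aemeasurable_uncurry (volume.restrict (Ici (0 : ℝ)))
  have h0 : ((P.prod (volume.restrict (Ici (0 : ℝ)))).map
      fun p : Ω × ℝ => σ p.2.toNNReal p.1) (Iio 0) = 0 := by
    rw [Measure.map_apply_of_aemeasurable hm measurableSet_Iio]
    have h := (Measure.quasiMeasurePreserving_fst (μ := P)
      (ν := volume.restrict (Ici (0 : ℝ)))).ae hσ.ae_nonneg
    refine measure_eq_zero_iff_ae_notMem.2 ?_
    filter_upwards [h] with p hp
    simpa using hp p.2.toNNReal
  ext A hA
  rw [← measure_inter_add_sdiff A (measurableSet_Ici (a := (0 : ℝ))),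
    ← hσ.potential_eq_map (hA.inter measurableSet_Ici),
    hu.density _ (hA.inter measurableSet_Ici) inter_subset_right,
    measure_mono_null (fun x hx => by simpa using hx.2) h0, add_zero,
    withDensity_apply _ hA, lintegral_indicator measurableSet_Ioi,
    Measure.restrict_restrict measurableSet_Ioi, inter_comm]
  exact setLIntegral_congr ((Ioi_ae_eq_Ici.symm).inter (ae_eq_refl A))

variable [IsProbabilityMeasure P]

/-- By Tonelli, ∫ e^{-lt} u(t) dt = ∫_0^∞ E[e^{-lσ(s)}] ds = ∫_0^∞ e^{-sΦ(l)} ds. -/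
theorem IsSubordinator.laplaceTransform_potentialDensity (hσ : IsSubordinator σ P)
    (hσΦ : HasLaplaceExponent σ P Φ) (hu : IsPotentialDensity σ P u) {l : ℝ} (hl : 0 < l)
    (hΦl : 0 < Φ l) :
    laplaceTransform ((Ioi (0 : ℝ)).indicator fun t => ENNReal.ofReal (u t)) l =
      ENNReal.ofReal (Φ l)⁻¹ := by
  have hm := hσ.aemeasurable_uncurry (volume.restrict (Ici (0 : ℝ)))
  have hum : Measurable ((Ioi (0 : ℝ)).indicator fun t => ENNReal.ofReal (u t)) :=
    measurable_indicator_of_antitoneOn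
      (ENNReal.ofReal_mono.comp_antitoneOn hu.antitone)
  calc laplaceTransform ((Ioi (0 : ℝ)).indicator fun t => ENNReal.ofReal (u t)) l
      = ∫⁻ t, ENNReal.ofReal (Real.exp (-(l * t)))
          ∂(volume.withDensity ((Ioi (0 : ℝ)).indicator fun t => ENNReal.ofReal (u t))) := by
        rw [lintegral_withDensity_eq_lintegral_mul _ hum (by fun_prop)]
        exact lintegral_congr fun t => mul_comm _ _
    _ = ∫⁻ s in Ici (0 : ℝ), ∫⁻ ω, ENNReal.ofReal (Real.exp (-(l * σ s.toNNReal ω))) ∂P := by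
        rw [← hσ.potential_measure_eq hu, lintegral_map' (by fun_prop) hm,
          lintegral_prod_symm]
        have h : Measurable fun x : ℝ => ENNReal.ofReal (Real.exp (-(l * x))) := by fun_prop
        exact h.comp_aemeasurable hm
    _ = ∫⁻ s in Ici (0 : ℝ), ENNReal.ofReal (Real.exp (-(Φ l) * s)) := by
        refine setLIntegral_congr_fun measurableSet_Ici fun s hs => ?_
        have hσm := hσ.measurable s.toNNReal
        rw [← ofReal_integral_eq_lintegral_ofReal _ (Eventually.of_forall fun _ => Real.exp_nonneg _),
          hσΦ _ _ hl, Real.coe_toNNReal s hs]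
        · ring_nf
        · refine Integrable.of_bound (by fun_prop) 1 ?_
          filter_upwards [hσ.ae_nonneg] with ω hω
          rw [Real.norm_eq_abs, Real.abs_exp, Real.exp_le_one_iff]
          have := mul_nonneg hl.le (hω s.toNNReal)
          linarith
    _ = ENNReal.ofReal (Φ l)⁻¹ := by
        rw [setLIntegral_congr Ioi_ae_eq_Ici.symm, ← ofReal_integral_eq_lintegral_ofReal]
        · rw [integral_exp_mul_Ioi (by linarith)]
          simp
        · exact integrableOn_exp_mul_Ioi (by linarith) 0
        · exact Eventually.of_forall fun _ => Real.exp_nonneg _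

end Potential

/-! ### The tail of the Lévy measure and its Laplace transform -/

section LevyTail

variable {Φ : ℝ → ℝ} {ν : Measure ℝ} {a b : ℝ}

theorem HasLevyTriple.measure_Ioi_lt_top (hν : HasLevyTriple Φ a b ν) {t : ℝ} (ht : 0 < t) :
    ν (Ioi t) < ∞ := by
  have hm : (0 : ℝ) < min 1 t := lt_min one_pos ht
  have h : ENNReal.ofReal (min 1 t) * ν (Ioi t) < ∞ := by
    refine lt_of_le_of_lt ?_ hν.integrable_min
    calc ENNReal.ofReal (min 1 t) * ν (Ioi t)
        = ∫⁻ _ in Ioi t, ENNReal.ofReal (min 1 t) ∂ν := by rw [setLIntegral_const]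
      _ ≤ ∫⁻ x in Ioi t, ENNReal.ofReal (min 1 x) ∂ν :=
          setLIntegral_mono (by fun_prop) fun x hx =>
            ENNReal.ofReal_le_ofReal (min_le_min_left _ (le_of_lt hx))
      _ ≤ _ := lintegral_mono_set (Ioi_subset_Ioi ht.le)
  by_contra h'
  rw [not_lt_top_iff] at h'
  rw [h', ENNReal.mul_top (by simpa using hm)] at h
  exact lt_irrefl _ h

/-- The layer-cake formula with weight e^{-lt}: integrating ∫_0^x e^{-lt} dt = (1 - e^{-lx})/l
against ν gives Φ(l)/l on one side and the transform of the tail on the other. -/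
theorem HasLevyTriple.laplaceTransform_tail (hν : HasLevyTriple Φ 0 0 ν) {l : ℝ} (hl : 0 < l) :
    laplaceTransform ((Ioi (0 : ℝ)).indicator fun t => ν (Ioi t)) l =
      ENNReal.ofReal (Φ l / l) := by
  have hG (x : ℝ) : ∫ t in (0 : ℝ)..x, Real.exp (-(l * t)) = (1 - Real.exp (-(l * x))) / l := by
    have h (t : ℝ) (_ : t ∈ uIcc 0 x) :
        HasDerivAt (fun t => -Real.exp (-(l * t)) / l) (Real.exp (-(l * t))) t := by
      have := ((hasDerivAt_id t).const_mul l).neg.exp.neg.div_const l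
      convert! this using 1
      field_simp
      simp
    rw [intervalIntegral.integral_eq_sub_of_hasDerivAt h
      (by apply Continuous.intervalIntegrable; fun_prop)]
    simp
    ring
  have hν0 : ∀ᵐ x ∂ν, x ∈ Ioi (0 : ℝ) := by
    rw [ae_iff]
    convert! hν.support using 2
    ext x
    simp
  have hint : Integrable (fun x => 1 - Real.exp (-(l * x))) (ν.restrict (Ioi 0)) := by
    -- Domination: 1 - e^{-lx} is at most 1 and at most lx.
    have h1 : Integrable (fun x : ℝ => max 1 l * min 1 x) (ν.restrict (Ioi 0)) := by
      refine Integrable.const_mul ?_ _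
      rw [← lintegral_ofReal_ne_top_iff_integrable (by fun_prop)]
      · exact hν.integrable_min.ne
      · filter_upwards [ae_restrict_mem measurableSet_Ioi] with x hx
        exact le_min zero_le_one (le_of_lt hx)
    refine h1.mono' (by fun_prop) ?_
    filter_upwards [ae_restrict_mem measurableSet_Ioi] with x (hx : 0 < x)
    have hlx := mul_pos hl hx
    have h2 := Real.add_one_le_exp (-(l * x))
    have h3 : Real.exp (-(l * x)) ≤ 1 := Real.exp_le_one_iff.2 (by linarith)
    rw [Real.norm_of_nonneg (by linarith)]
    rcases le_total 1 x with h | h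
    · rw [min_eq_left h]
      have := le_max_left 1 l
      have := Real.exp_nonneg (-(l * x))
      linarith
    · rw [min_eq_right h]
      have : l * x ≤ max 1 l * x := by gcongr; exact le_max_right _ _
      linarith
  have hres : ν.restrict (Ioi 0) = ν := Measure.restrict_eq_self_of_ae_mem hν0
  have key := lintegral_comp_eq_lintegral_meas_lt_mul ν (f := id)
    (g := fun t => Real.exp (-(l * t)))
    (by filter_upwards [hν0] with x hx using le_of_lt hx) aemeasurable_id
    (fun t _ => by apply Continuous.intervalIntegrable; fun_prop)
    (Eventually.of_forall fun _ => Real.exp_nonneg _)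
  simp only [id_eq, hG] at key
  have hΦ := hν.repr l hl
  simp only [zero_mul, zero_add] at hΦ
  rw [hΦ, ← integral_div, ofReal_integral_eq_lintegral_ofReal (hint.div_const l), hres, key,
    laplaceTransform, ← lintegral_indicator measurableSet_Ioi]
  · refine lintegral_congr fun t => ?_
    by_cases ht : t ∈ Ioi (0 : ℝ)
    · simp only [indicator_of_mem ht]
      rw [mul_comm]
      rfl
    · simp only [indicator_of_notMem ht, mul_zero]
  · filter_upwards [ae_restrict_mem measurableSet_Ioi] with x (hx : 0 < x)
    have hlx := mul_pos hl hx
    have h3 : Real.exp (-(l * x)) ≤ 1 := Real.exp_le_one_iff.2 (by linarith)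
    exact div_nonneg (by linarith) hl.le

end LevyTail

/-! ### Volterra kernels and the Sonine relation -/

/-- Non-negative non-increasing kernels on `(0, ∞)` that are integrable near `0`. -/
structure IsVolterraKernel (a : ℝ → ℝ) : Prop where
  nonneg : ∀ t : ℝ, 0 < t → 0 ≤ a t
  antitone : AntitoneOn a (Ioi 0)
  integrableOn : ∀ t : ℝ, IntegrableOn a (Ioc 0 t)

/-- The extension by zero of a kernel on `(0, ∞)`, with values in `[0, ∞]`. -/
noncomputable def extendKernel (a : ℝ → ℝ) : ℝ → ℝ≥0∞ :=
  (Ioi (0 : ℝ)).indicator fun t => ENNReal.ofReal (a t)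

/-- The Sonine relation: the convolution of two kernels is `1` on `(0, ∞)`. -/
def IsSoninePair (a b : ℝ → ℝ) : Prop :=
  extendKernel a ⋆ₗ extendKernel b =ᵐ[volume] (Ioi (0 : ℝ)).indicator 1

theorem IsSoninePair.symm {a b : ℝ → ℝ} (h : IsSoninePair a b) : IsSoninePair b a := by
  rwa [IsSoninePair, lconvolution_comm]

theorem measurable_extendKernel {a : ℝ → ℝ} (ha : AntitoneOn a (Ioi 0)) :
    Measurable (extendKernel a) :=
  measurable_indicator_of_antitoneOn (ENNReal.ofReal_mono.comp_antitoneOn ha)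

/-- On (0, t] one has 1 ≤ e^t e^{-s}, so a finite transform at 1 bounds the integral of the kernel.
-/
theorem isVolterraKernel_of_laplaceTransform {a : ℝ → ℝ} (h0 : ∀ t : ℝ, 0 < t → 0 ≤ a t)
    (ha : AntitoneOn a (Ioi 0)) (h : laplaceTransform (extendKernel a) 1 < ∞) :
    IsVolterraKernel a where
  nonneg := h0
  antitone := ha
  integrableOn t := by
    have hm : AEStronglyMeasurable a (volume.restrict (Ioc 0 t)) :=
      (aemeasurable_restrict_of_antitoneOn measurableSet_Ioc
        (ha.mono Ioc_subset_Ioi_self)).aestronglyMeasurable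
    have hnn : 0 ≤ᵐ[volume.restrict (Ioc 0 t)] a := by
      filter_upwards [ae_restrict_mem measurableSet_Ioc] with s hs using h0 s hs.1
    rw [IntegrableOn, ← lintegral_ofReal_ne_top_iff_integrable hm hnn]
    refine ne_of_lt (lt_of_le_of_lt ?_ (ENNReal.mul_lt_top
      (ENNReal.ofReal_lt_top (r := Real.exp t)) h))
    rw [laplaceTransform, ← lintegral_const_mul _
      (by have := measurable_extendKernel ha; fun_prop), ← lintegral_indicator measurableSet_Ioc]
    refine lintegral_mono fun s => ?_
    by_cases hs : s ∈ Ioc 0 t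
    · rw [indicator_of_mem hs, extendKernel, indicator_of_mem (show s ∈ Ioi 0 from hs.1),
        ← mul_assoc, ← ENNReal.ofReal_mul (Real.exp_nonneg _), ← Real.exp_add]
      refine le_mul_of_one_le_left zero_le ?_
      rw [ENNReal.one_le_ofReal, Real.one_le_exp_iff]
      linarith [hs.2]
    · simp [indicator_of_notMem hs]

theorem isSoninePair_of_laplaceTransform {a b : ℝ → ℝ} (ha : AntitoneOn a (Ioi 0))
    (hb : AntitoneOn b (Ioi 0))
    (h : ∀ l : ℝ, 0 < l → laplaceTransform (extendKernel a) l *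
      laplaceTransform (extendKernel b) l = ENNReal.ofReal l⁻¹) :
    IsSoninePair a b := by
  refine HasLaplaceInv.ae_eq ⟨?_, fun t ht => ?_, fun l hl => ?_⟩ hasLaplaceInv_indicator_one
  · exact measurable_lconvolution _ (measurable_extendKernel ha) (measurable_extendKernel hb)
  · rw [lconvolution_def]
    refine lintegral_eq_zero_of_ae_eq_zero (Eventually.of_forall fun s => ?_)
    rcases le_or_gt s 0 with hs | hs
    · simp [extendKernel, hs]
    · have : ¬ (0 < -s + t) := by linarith
      simp [extendKernel, -lt_neg_add_iff_add_lt, this]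
  · rw [laplaceTransform_lconvolution (measurable_extendKernel ha) (measurable_extendKernel hb),
      h l hl]

section Sonine

variable {Ω : Type*} [MeasurableSpace Ω] {P : Measure Ω} [IsProbabilityMeasure P]
  {σ : ℝ≥0 → Ω → ℝ} {Φ u : ℝ → ℝ} {ν : Measure ℝ}

theorem IsPotentialDensity.isVolterraKernel (hu : IsPotentialDensity σ P u)
    (hσ : IsSubordinator σ P) (hσΦ : HasLaplaceExponent σ P Φ) (hΦ : ∀ l, 0 < l → 0 < Φ l) :
    IsVolterraKernel u := by
  refine isVolterraKernel_of_laplaceTransform hu.nonneg hu.antitone ?_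
  rw [extendKernel, hσ.laplaceTransform_potentialDensity hσΦ hu one_pos (hΦ 1 one_pos)]
  exact ENNReal.ofReal_lt_top

theorem HasLevyTriple.antitoneOn_tail (hν : HasLevyTriple Φ 0 0 ν) :
    AntitoneOn (fun t => (ν (Ioi t)).toReal) (Ioi 0) := fun _ hs _ _ hst =>
  ENNReal.toReal_mono (hν.measure_Ioi_lt_top hs).ne (measure_mono (Ioi_subset_Ioi hst))

theorem HasLevyTriple.extendKernel_tail (hν : HasLevyTriple Φ 0 0 ν) :
    extendKernel (fun t => (ν (Ioi t)).toReal) = (Ioi (0 : ℝ)).indicator fun t => ν (Ioi t) :=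
  indicator_congr fun _ ht => ENNReal.ofReal_toReal (hν.measure_Ioi_lt_top ht).ne

theorem HasLevyTriple.isVolterraKernel_tail (hν : HasLevyTriple Φ 0 0 ν) :
    IsVolterraKernel (fun t => (ν (Ioi t)).toReal) := by
  refine isVolterraKernel_of_laplaceTransform (fun _ _ => ENNReal.toReal_nonneg)
    hν.antitoneOn_tail ?_
  rw [hν.extendKernel_tail, hν.laplaceTransform_tail one_pos]
  exact ENNReal.ofReal_lt_top

/-- The potential density and the tail of the Lévy measure form a Sonine pair. -/
theorem IsPotentialDensity.isSoninePair (hu : IsPotentialDensity σ P u)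
    (hσ : IsSubordinator σ P) (hσΦ : HasLaplaceExponent σ P Φ) (hΦ : ∀ l, 0 < l → 0 < Φ l)
    (hν : HasLevyTriple Φ 0 0 ν) :
    IsSoninePair u fun t => (ν (Ioi t)).toReal := by
  refine isSoninePair_of_laplaceTransform hu.antitone hν.antitoneOn_tail fun l hl => ?_
  have := hΦ l hl
  rw [hν.extendKernel_tail, hν.laplaceTransform_tail hl, extendKernel,
    hσ.laplaceTransform_potentialDensity hσΦ hu hl this, ← ENNReal.ofReal_mul (by positivity)]
  congr 1
  field_simp

end Sonine

/-! ### Convolution with a Sonine pair is integration -/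

section Volterra

variable {X : Type*} [NormedAddCommGroup X] [NormedSpace ℝ X]

/-- The Volterra convolution `∫_0^t a(t - s) f(s) ds`. -/
noncomputable def volterra (a : ℝ → ℝ) (f : ℝ → X) (t : ℝ) : X :=
  ∫ s in (0 : ℝ)..t, a (t - s) • f s

variable {a b : ℝ → ℝ} {f : ℝ → X} {t : ℝ}

theorem volterra_congr_ae {g : ℝ → X} (ht : 0 ≤ t)
    (h : ∀ᵐ s ∂(volume.restrict (Ioo 0 t)), f s = g s) : volterra a f t = volterra a g t := by
  rw [volterra, volterra, intervalIntegral.integral_of_le ht, intervalIntegral.integral_of_le ht,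
    integral_Ioc_eq_integral_Ioo, integral_Ioc_eq_integral_Ioo]
  refine integral_congr_ae ?_
  filter_upwards [h] with s hs
  rw [hs]

theorem extendKernel_of_nonpos (a : ℝ → ℝ) (ht : t ≤ 0) : extendKernel a t = 0 := by
  simp [extendKernel, ht]

theorem IsVolterraKernel.toReal_extendKernel (ha : IsVolterraKernel a) (ht : 0 < t) :
    (extendKernel a t).toReal = a t := by
  simp [extendKernel, ht, ha.nonneg t ht]

theorem extendKernel_ne_top (a : ℝ → ℝ) (t : ℝ) : extendKernel a t ≠ ∞ := by
  rcases le_or_gt t 0 with ht | ht <;> simp [extendKernel, ht]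

/-- Moving the limits of integration into the zero-extended kernel and function gives a full-line
integral, ready for Fubini. -/
theorem volterra_eq_integral_indicator (ha : IsVolterraKernel a) {T : ℝ} (ht : t ∈ Icc 0 T) :
    volterra a f t = ∫ s, (extendKernel a (t - s)).toReal • (Ioo 0 T).indicator f s := by
  rw [volterra, intervalIntegral.integral_of_le ht.1, integral_Ioc_eq_integral_Ioo,
    ← integral_indicator measurableSet_Ioo]
  refine integral_congr_ae (Eventually.of_forall fun s => ?_)
  rcases le_or_gt s 0 with hs | hs
  · simp [hs]
  rcases le_or_gt t s with hs' | hs'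
  · simp [hs', extendKernel_of_nonpos]
  · have : s < T := hs'.trans_le ht.2
    simp [hs, hs', this, ha.toReal_extendKernel (sub_pos.2 hs')]

theorem lintegral_extendKernel_mul_extendKernel (a b : ℝ → ℝ) (t r : ℝ) :
    ∫⁻ s, extendKernel a (t - s) * extendKernel b (s - r) =
      (extendKernel a ⋆ₗ extendKernel b) (t - r) := by
  rw [lconvolution_def, ← lintegral_sub_left_eq_self _ t]
  refine lintegral_congr fun s => ?_
  congr 2 <;> ring

theorem IsSoninePair.ae_eq (hab : IsSoninePair a b) (t : ℝ) :
    ∀ᵐ r : ℝ, (extendKernel a ⋆ₗ extendKernel b) (t - r) = (Iio t).indicator 1 r := by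
  have h := (Measure.measurePreserving_sub_left volume t).quasiMeasurePreserving.ae hab
  filter_upwards [h] with r hr
  rw [hr]
  by_cases hrt : r < t <;> simp [hrt]

variable [CompleteSpace X]

/-- After Fubini, the inner integral over s is (a * b)(t - r), which is 1 for r < t and 0 otherwise,
for almost every r. The same computation with norms bounds the double integral by ∫‖f‖ and so
justifies the exchange. -/
theorem integral_extendKernel_integral_extendKernel (ha : IsVolterraKernel a)
    (hb : IsVolterraKernel b) (hab : IsSoninePair a b) (hf : Integrable f) (t : ℝ) :
    ∫ s, (extendKernel a (t - s)).toReal • ∫ r, (extendKernel b (s - r)).toReal • f r =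
      ∫ r in Iio t, f r := by
  have hA := measurable_extendKernel ha.antitone
  have hB := measurable_extendKernel hb.antitone
  have hint : Integrable (fun p : ℝ × ℝ =>
      ((extendKernel a (t - p.1)).toReal * (extendKernel b (p.1 - p.2)).toReal) • f p.2)
      (volume.prod volume) := by
    have hmeas : AEStronglyMeasurable (fun p : ℝ × ℝ =>
        ((extendKernel a (t - p.1)).toReal * (extendKernel b (p.1 - p.2)).toReal) • f p.2)
        (volume.prod volume) := by
      refine AEStronglyMeasurable.smul (Measurable.aestronglyMeasurable (by fun_prop)) ?_
      exact hf.aestronglyMeasurable.comp_snd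
    refine ⟨hmeas, ?_⟩
    rw [HasFiniteIntegral, lintegral_prod_symm _ hmeas.enorm]
    refine lt_of_le_of_lt (lintegral_mono_ae (g := fun r => ‖f r‖ₑ) ?_) hf.hasFiniteIntegral
    filter_upwards [hab.ae_eq t] with r hr
    simp only [enorm_smul, enorm_mul, Real.enorm_eq_ofReal ENNReal.toReal_nonneg,
      ENNReal.ofReal_toReal (extendKernel_ne_top _ _)]
    rw [lintegral_mul_const _ (by fun_prop), lintegral_extendKernel_mul_extendKernel, hr]
    refine mul_le_of_le_one_left zero_le ?_
    exact indicator_le_self' (fun _ _ => zero_le) r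
  calc ∫ s, (extendKernel a (t - s)).toReal • ∫ r, (extendKernel b (s - r)).toReal • f r
      = ∫ s, ∫ r, ((extendKernel a (t - s)).toReal * (extendKernel b (s - r)).toReal) • f r := by
        refine integral_congr_ae (Eventually.of_forall fun s => ?_)
        simp only [mul_smul]
        rw [integral_smul]
    _ = ∫ r, ∫ s, ((extendKernel a (t - s)).toReal * (extendKernel b (s - r)).toReal) • f r :=
        integral_integral_swap hint
    _ = ∫ r, (Iio t).indicator f r := by
        refine integral_congr_ae ?_
        filter_upwards [hab.ae_eq t] with r hr
        rw [integral_smul_const]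
        have h : ∫ s, (extendKernel a (t - s)).toReal * (extendKernel b (s - r)).toReal =
            ((extendKernel a ⋆ₗ extendKernel b) (t - r)).toReal := by
          rw [← lintegral_extendKernel_mul_extendKernel, ← integral_toReal (by fun_prop)]
          · simp only [ENNReal.toReal_mul]
          · exact Eventually.of_forall fun s =>
              (ENNReal.mul_ne_top (extendKernel_ne_top _ _) (extendKernel_ne_top _ _)).lt_top
        rw [h, hr]
        by_cases hrt : r < t <;> simp [hrt]
    _ = ∫ r in Iio t, f r := integral_indicator measurableSet_Iio

theorem volterra_volterra (ha : IsVolterraKernel a) (hb : IsVolterraKernel b)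
    (hab : IsSoninePair a b) (ht : 0 ≤ t) (hf : IntegrableOn f (Ioc 0 t)) :
    volterra a (volterra b f) t = ∫ s in (0 : ℝ)..t, f s := by
  have hH : Integrable ((Ioo 0 t).indicator f) :=
    (integrable_indicator_iff measurableSet_Ioo).2 (hf.mono_set Ioo_subset_Ioc_self)
  have h := integral_extendKernel_integral_extendKernel ha hb hab hH t
  rw [volterra_eq_integral_indicator ha ⟨ht, le_rfl⟩, intervalIntegral.integral_of_le ht,
    integral_Ioc_eq_integral_Ioo]
  rw [setIntegral_indicator measurableSet_Ioo, inter_eq_right.2 fun x hx => hx.2] at h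
  rw [← h]
  refine integral_congr_ae (Eventually.of_forall fun s => ?_)
  rcases le_or_gt t s with hs' | hs'
  · simp [hs', extendKernel_of_nonpos]
  rcases le_or_gt s 0 with hs | hs
  · have h0 : ∫ r, (extendKernel b (s - r)).toReal • (Ioo 0 t).indicator f r = 0 := by
      refine integral_eq_zero_of_ae (Eventually.of_forall fun r => ?_)
      rcases le_or_gt r 0 with hr | hr
      · simp [hr]
      · simp [extendKernel_of_nonpos b (show s - r ≤ 0 by linarith)]
    simp [h0, hs]
  · dsimp only
    rw [indicator_of_mem (show s ∈ Ioo 0 t from ⟨hs, hs'⟩),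
      volterra_eq_integral_indicator hb (T := t) ⟨hs.le, hs'.le⟩]

end Volterra

/-! ### Norm bounds and continuity of Volterra convolutions -/

section VolterraBounds

variable {X : Type*} [NormedAddCommGroup X] [NormedSpace ℝ X]
variable {a b : ℝ → ℝ} {f g : ℝ → X} {t T M : ℝ}

theorem IsVolterraKernel.intervalIntegrable (ha : IsVolterraKernel a) {s t : ℝ} (hs : 0 ≤ s)
    (ht : 0 ≤ t) : IntervalIntegrable a volume s t := by
  have h (r : ℝ) (hr : 0 ≤ r) : IntervalIntegrable a volume 0 r :=
    (intervalIntegrable_iff_integrableOn_Ioc_of_le hr).2 (ha.integrableOn r)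
  exact (h s hs).symm.trans (h t ht)

theorem ae_restrict_Ioc_of_Icc {p : ℝ → Prop} (ht : t ≤ T)
    (h : ∀ᵐ s ∂(volume.restrict (Icc 0 T)), p s) : ∀ᵐ s ∂(volume.restrict (Ioc 0 t)), p s :=
  ae_restrict_of_ae_restrict_of_subset (s := Ioc 0 t) (t := Icc 0 T)
    (fun _ hs => ⟨hs.1.le, hs.2.trans ht⟩) h

theorem IsVolterraKernel.intervalIntegrable_smul (ha : IsVolterraKernel a) {r : ℝ}
    (hr : r ∈ Icc 0 t) (htT : t ≤ T) (hf : AEStronglyMeasurable f (volume.restrict (Icc 0 T)))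
    (hM : ∀ᵐ s ∂(volume.restrict (Icc 0 T)), ‖f s‖ ≤ M) {c d : ℝ} (hc : c ∈ Icc 0 t)
    (hd : d ∈ Icc 0 t) :
    IntervalIntegrable (fun s => a (t - s) • f s) volume c d := by
  have h0 : IntervalIntegrable (fun s => a (t - s) • f s) volume 0 t := by
    have ht : 0 ≤ t := hr.1.trans hr.2
    have h1 : IntervalIntegrable (fun s => a (t - s)) volume 0 t := by
      simpa using (ha.intervalIntegrable ht le_rfl).comp_sub_left t
    rw [intervalIntegrable_iff_integrableOn_Ioc_of_le ht] at h1 ⊢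
    refine Integrable.smul_bdd h1 M ?_ (ae_restrict_Ioc_of_Icc htT hM)
    exact hf.mono_measure (Measure.restrict_mono (s := Ioc 0 t) (s' := Icc 0 T)
      (fun _ hs => ⟨hs.1.le, hs.2.trans htT⟩) le_rfl)
  have h1 {c : ℝ} (hc : c ∈ Icc 0 t) : IntervalIntegrable (fun s => a (t - s) • f s) volume 0 c :=
    h0.mono_set (uIcc_subset_uIcc left_mem_uIcc (by rwa [uIcc_of_le (hc.1.trans hc.2)]))
  exact (h1 hc).symm.trans (h1 hd)

/-- Writing e^{cs} = e^{ct} e^{-c(t-s)} moves the weight onto the kernel, whose weighted integral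
becomes small for large c. -/
theorem norm_volterra_le_exp (ha : IsVolterraKernel a) (ht : 0 ≤ t) {c : ℝ}
    (hM : ∀ᵐ s ∂(volume.restrict (Ioc 0 t)), ‖f s‖ ≤ M * Real.exp (c * s)) :
    ‖volterra a f t‖ ≤ M * Real.exp (c * t) * ∫ s in (0 : ℝ)..t, Real.exp (-(c * s)) * a s := by
  have h1 : IntervalIntegrable (fun s => Real.exp (-(c * s)) * a s) volume 0 t :=
    (ha.intervalIntegrable le_rfl ht).continuousOn_mul (by fun_prop)
  have h2 : (∫ s in (0 : ℝ)..t, Real.exp (-(c * (t - s))) * a (t - s)) =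
      ∫ s in (0 : ℝ)..t, Real.exp (-(c * s)) * a s := by
    simpa using intervalIntegral.integral_comp_sub_left
      (fun s => Real.exp (-(c * s)) * a s) t (a := 0) (b := t)
  rw [← h2, ← intervalIntegral.integral_const_mul]
  refine intervalIntegral.norm_integral_le_of_norm_le ht ?_ ?_
  · rw [← ae_restrict_iff' measurableSet_Ioc]
    -- The endpoint is discarded because nothing is known about the value of the kernel at 0.
    have hne : ∀ᵐ s ∂(volume.restrict (Ioc 0 t)), s ≠ t :=
      ae_restrict_of_ae (by simp [ae_iff, measure_singleton])
    filter_upwards [hM, hne, ae_restrict_mem measurableSet_Ioc] with s hs hst hs'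
    have hts : 0 < t - s := sub_pos.2 (lt_of_le_of_ne hs'.2 hst)
    have := ha.nonneg _ hts
    rw [norm_smul, Real.norm_of_nonneg this]
    have e : M * Real.exp (c * t) * (Real.exp (-(c * (t - s))) * a (t - s)) =
        a (t - s) * (M * Real.exp (c * s)) := by
      rw [show c * s = c * t + -(c * (t - s)) by ring, Real.exp_add]
      ring
    rw [e]
    gcongr
  · refine IntervalIntegrable.const_mul ?_ _
    simpa using (h1.comp_sub_left t).symm

theorem norm_volterra_le (ha : IsVolterraKernel a) (ht : 0 ≤ t)
    (hM : ∀ᵐ s ∂(volume.restrict (Ioc 0 t)), ‖f s‖ ≤ M) :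
    ‖volterra a f t‖ ≤ M * ∫ s in (0 : ℝ)..t, a s := by
  have := norm_volterra_le_exp (c := 0) (M := M) (f := f) ha ht (by simpa using hM)
  simpa using this

theorem IsVolterraKernel.integral_mono (ha : IsVolterraKernel a) (ht : 0 ≤ t) (htT : t ≤ T) :
    ∫ s in (0 : ℝ)..t, a s ≤ ∫ s in (0 : ℝ)..T, a s := by
  rw [intervalIntegral.integral_of_le ht, intervalIntegral.integral_of_le (ht.trans htT)]
  refine setIntegral_mono_set (ha.integrableOn T) ?_ ?_
  · filter_upwards [ae_restrict_mem measurableSet_Ioc] with s hs using ha.nonneg s hs.1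
  · exact (Ioc_subset_Ioc_right htT).eventuallyLE

theorem IsVolterraKernel.continuousOn_integral (ha : IsVolterraKernel a) (hT : 0 ≤ T) :
    ContinuousOn (fun t => ∫ s in (0 : ℝ)..t, a s) (Icc 0 T) := by
  have := intervalIntegral.continuousOn_primitive_interval'
    (ha.intervalIntegrable le_rfl hT) left_mem_uIcc
  rwa [uIcc_of_le hT] at this

theorem IsVolterraKernel.tendsto_integral (ha : IsVolterraKernel a) :
    Tendsto (fun t => ∫ s in (0 : ℝ)..t, a s) (𝓝[≥] 0) (𝓝 0) := by
  have h := ha.continuousOn_integral zero_le_one 0 (by simp)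
  rw [ContinuousWithinAt, intervalIntegral.integral_same,
    nhdsWithin_Icc_eq_nhdsGE one_pos] at h
  exact h

/-- As the kernel is non-increasing, |a(t-r) - a(s-r)| = a(s-r) - a(t-r), with integral ∫_0^s a -
∫_{t-s}^t a ≤ ∫_0^{t-s} a over [0, s]. The piece over [s, t] contributes ∫_0^{t-s} a once more,
whence the factor 2. -/
theorem norm_volterra_sub_le (ha : IsVolterraKernel a)
    (hf : AEStronglyMeasurable f (volume.restrict (Icc 0 T)))
    (hM : ∀ᵐ s ∂(volume.restrict (Icc 0 T)), ‖f s‖ ≤ M) {s : ℝ} (hs : 0 ≤ s) (hst : s ≤ t)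
    (htT : t ≤ T) :
    ‖volterra a f t - volterra a f s‖ ≤ 2 * M * ∫ r in (0 : ℝ)..(t - s), a r := by
  have ht : 0 ≤ t := hs.trans hst
  have hf' {c d : ℝ} (hc : c ∈ Icc 0 t) (hd : d ∈ Icc 0 t) :=
    ha.intervalIntegrable_smul (r := 0) ⟨le_rfl, ht⟩ htT hf hM hc hd
  have h0 : (0 : ℝ) ∈ Icc 0 t := ⟨le_rfl, ht⟩
  have h2 := ha.intervalIntegrable_smul (r := 0) ⟨le_rfl, hs⟩ (hst.trans htT) hf hM
    ⟨le_rfl, hs⟩ ⟨hs, le_rfl⟩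
  have e : volterra a f t - volterra a f s =
      (∫ r in (0 : ℝ)..s, (a (t - r) - a (s - r)) • f r) + ∫ r in s..t, a (t - r) • f r := by
    rw [volterra, volterra, ← intervalIntegral.integral_add_adjacent_intervals
      (hf' h0 ⟨hs, hst⟩) (hf' ⟨hs, hst⟩ ⟨ht, le_rfl⟩)]
    simp only [sub_smul]
    rw [intervalIntegral.integral_sub (hf' h0 ⟨hs, hst⟩) h2]
    abel
  have i1 : IntervalIntegrable (fun r => a (t - r)) volume 0 s := by
    have := (ha.intervalIntegrable (s := t) (t := t - s) ht (by linarith)).comp_sub_left t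
    simpa using this
  have i2 : IntervalIntegrable (fun r => a (s - r)) volume 0 s := by
    have := (ha.intervalIntegrable (s := s) (t := 0) hs le_rfl).comp_sub_left s
    simpa using this
  have i3 : IntervalIntegrable (fun r => a (t - r)) volume s t := by
    have := (ha.intervalIntegrable (s := t - s) (t := 0) (by linarith) le_rfl).comp_sub_left t
    simpa using this
  have n1 : ‖∫ r in (0 : ℝ)..s, (a (t - r) - a (s - r)) • f r‖ ≤
      ∫ r in (0 : ℝ)..s, M * (a (s - r) - a (t - r)) := by
    refine intervalIntegral.norm_integral_le_of_norm_le hs ?_ ((i2.sub i1).const_mul M)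
    rw [← ae_restrict_iff' measurableSet_Ioc]
    have hne : ∀ᵐ r ∂(volume.restrict (Ioc 0 s)), r ≠ s :=
      ae_restrict_of_ae (by simp [ae_iff, measure_singleton])
    filter_upwards [ae_restrict_Ioc_of_Icc (hst.trans htT) hM, hne,
      ae_restrict_mem measurableSet_Ioc] with r hr hrs hr'
    have hsr : 0 < s - r := sub_pos.2 (lt_of_le_of_ne hr'.2 hrs)
    have h := ha.antitone (show s - r ∈ Ioi 0 from hsr)
      (show t - r ∈ Ioi 0 from hsr.trans_le (by linarith)) (by linarith)
    rw [norm_smul, norm_sub_rev, Real.norm_of_nonneg (sub_nonneg.2 h), mul_comm]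
    exact mul_le_mul_of_nonneg_right hr (sub_nonneg.2 h)
  have n2 : ‖∫ r in s..t, a (t - r) • f r‖ ≤ ∫ r in s..t, M * a (t - r) := by
    refine intervalIntegral.norm_integral_le_of_norm_le hst ?_ (i3.const_mul M)
    rw [← ae_restrict_iff' measurableSet_Ioc]
    have hne : ∀ᵐ r ∂(volume.restrict (Ioc s t)), r ≠ t :=
      ae_restrict_of_ae (by simp [ae_iff, measure_singleton])
    have hM' : ∀ᵐ r ∂(volume.restrict (Ioc s t)), ‖f r‖ ≤ M :=
      ae_restrict_of_ae_restrict_of_subset (Ioc_subset_Ioc_left hs)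
        (ae_restrict_Ioc_of_Icc htT hM)
    filter_upwards [hM', hne, ae_restrict_mem measurableSet_Ioc] with r hr hrs hr'
    have h := ha.nonneg _ (sub_pos.2 (lt_of_le_of_ne hr'.2 hrs))
    rw [norm_smul, Real.norm_of_nonneg h, mul_comm]
    exact mul_le_mul_of_nonneg_right hr h
  have e1 : ∫ r in (0 : ℝ)..s, M * (a (s - r) - a (t - r)) =
      M * ((∫ r in (0 : ℝ)..s, a r) - ∫ r in (t - s)..t, a r) := by
    rw [intervalIntegral.integral_const_mul, intervalIntegral.integral_sub i2 i1,
      intervalIntegral.integral_comp_sub_left, intervalIntegral.integral_comp_sub_left]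
    simp
  have e2 : ∫ r in s..t, M * a (t - r) = M * ∫ r in (0 : ℝ)..(t - s), a r := by
    rw [intervalIntegral.integral_const_mul, intervalIntegral.integral_comp_sub_left]
    simp
  have e3 := intervalIntegral.integral_add_adjacent_intervals
    (ha.intervalIntegrable (s := 0) (t := t - s) le_rfl (by linarith))
    (ha.intervalIntegrable (s := t - s) (t := t) (by linarith) ht)
  have h4 := ha.integral_mono hs hst
  rw [e]
  refine (norm_add_le _ _).trans ((add_le_add n1 n2).trans ?_)
  rw [e1, e2]
  rcases le_or_gt 0 M with hM0 | hM0
  · have : M * ((∫ r in (0 : ℝ)..s, a r) - ∫ r in (t - s)..t, a r) ≤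
        M * ∫ r in (0 : ℝ)..(t - s), a r := by
      gcongr
      linarith
    linarith
  -- A negative bound on a norm can hold almost everywhere only on a null interval, which forces s =
  -- t = 0.
  · have hz : volume (Icc 0 T) = 0 := by
      have h : ∀ᵐ s ∂(volume.restrict (Icc 0 T)), False := by
        filter_upwards [hM] with s hs
        linarith [norm_nonneg (f s)]
      rwa [eventually_false_iff_eq_bot, ae_eq_bot, Measure.restrict_eq_zero] at h
    rw [Real.volume_Icc, ENNReal.ofReal_eq_zero] at hz
    obtain rfl : t = 0 := by linarith
    obtain rfl : s = 0 := by linarith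
    simp

theorem continuousOn_volterra (ha : IsVolterraKernel a)
    (hf : AEStronglyMeasurable f (volume.restrict (Icc 0 T)))
    (hM : ∀ᵐ s ∂(volume.restrict (Icc 0 T)), ‖f s‖ ≤ M) :
    ContinuousOn (volterra a f) (Icc 0 T) := by
  intro t ht
  have key : ∀ s ∈ Icc 0 T, dist (volterra a f s) (volterra a f t) ≤
      2 * M * ∫ r in (0 : ℝ)..|s - t|, a r := by
    intro s hs
    rw [dist_eq_norm]
    rcases le_total s t with h | h
    · rw [norm_sub_rev, abs_sub_comm, abs_of_nonneg (sub_nonneg.2 h)]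
      exact norm_volterra_sub_le ha hf hM hs.1 h ht.2
    · rw [abs_of_nonneg (sub_nonneg.2 h)]
      exact norm_volterra_sub_le ha hf hM ht.1 h hs.2
  refine tendsto_iff_dist_tendsto_zero.2 ?_
  have hlim : Tendsto (fun s => |s - t|) (𝓝[Icc 0 T] t) (𝓝[≥] 0) := by
    refine tendsto_nhdsWithin_iff.2 ⟨?_, Eventually.of_forall fun s => mem_Ici.2 (abs_nonneg _)⟩
    have : Continuous fun s => |s - t| := by fun_prop
    simpa using (this.tendsto t).mono_left (nhdsWithin_le_nhds (s := Icc 0 T))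
  have h2 := (ha.tendsto_integral.comp hlim).const_mul (2 * M)
  rw [mul_zero] at h2
  refine squeeze_zero' (Eventually.of_forall fun _ => dist_nonneg) ?_ h2
  filter_upwards [self_mem_nhdsWithin] with s hs using key s hs

theorem volterra_sub (ha : IsVolterraKernel a) (ht : t ∈ Icc 0 T)
    (hf : AEStronglyMeasurable f (volume.restrict (Icc 0 T)))
    (hM : ∀ᵐ s ∂(volume.restrict (Icc 0 T)), ‖f s‖ ≤ M)
    (hg : AEStronglyMeasurable g (volume.restrict (Icc 0 T))) {N : ℝ}
    (hN : ∀ᵐ s ∂(volume.restrict (Icc 0 T)), ‖g s‖ ≤ N) :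
    volterra a (fun s => f s - g s) t = volterra a f t - volterra a g t := by
  have h0 : (0 : ℝ) ∈ Icc 0 t := ⟨le_rfl, ht.1⟩
  have h1 : t ∈ Icc 0 t := ⟨ht.1, le_rfl⟩
  simp only [volterra, smul_sub]
  exact intervalIntegral.integral_sub
    (ha.intervalIntegrable_smul h0 ht.2 hf hM h0 h1) (ha.intervalIntegrable_smul h0 ht.2 hg hN h0 h1)

end VolterraBounds

/-! ### Measurability of superpositions -/

section Caratheodory

variable {X : Type*} [NormedAddCommGroup X]

/-- Superposition of a Carathéodory function, Lipschitz on a set, with a continuous function. -/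
theorem aestronglyMeasurable_comp_of_lipschitz {μ : Measure ℝ} {G : ℝ → X → X}
    (hG : ∀ x, AEStronglyMeasurable (fun t => G t x) μ) {S : Set X} {L : ℝ}
    (hL : ∀ᵐ t ∂μ, ∀ x ∈ S, ∀ z ∈ S, ‖G t x - G t z‖ ≤ L * ‖x - z‖) {f : ℝ → X}
    (hf : Continuous f) (hfS : ∀ t, f t ∈ S) : AEStronglyMeasurable (fun t => G t (f t)) μ := by
  -- Along the grid, f(p n t) is constant on countably many pieces, where measurability of G(·, x)
  -- for fixed x suffices; the Lipschitz bound gives the limit.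
  let p (n : ℕ) (t : ℝ) : ℝ := ⌊(n : ℝ) * t⌋ / n
  have hp (t : ℝ) : Tendsto (fun n => p n t) atTop (𝓝 t) := by
    have h1 : Tendsto (fun n : ℕ => t - 1 / (n : ℝ)) atTop (𝓝 t) := by
      simpa using tendsto_const_nhds.sub (tendsto_one_div_atTop_nhds_zero_nat (𝕜 := ℝ))
    refine tendsto_of_tendsto_of_tendsto_of_le_of_le' h1 tendsto_const_nhds ?_ ?_
    · filter_upwards [eventually_gt_atTop 0] with n hn
      have hn' : (0 : ℝ) < n := by exact_mod_cast hn
      rw [le_div_iff₀ hn', sub_mul, one_div, inv_mul_cancel₀ hn'.ne', mul_comm]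
      exact (Int.sub_one_lt_floor _).le
    · filter_upwards [eventually_gt_atTop 0] with n hn
      have hn' : (0 : ℝ) < n := by exact_mod_cast hn
      rw [div_le_iff₀ hn', mul_comm t]
      exact Int.floor_le _
  refine aestronglyMeasurable_of_tendsto_ae atTop (f := fun n t => G t (f (p n t))) (fun n => ?_) ?_
  · have hcover : (⋃ k : ℤ, {t : ℝ | ⌊(n : ℝ) * t⌋ = k}) = univ := by
      ext t
      simp
    rw [← Measure.restrict_univ (μ := μ), ← hcover, aestronglyMeasurable_iUnion_iff]
    intro k
    have hk : MeasurableSet {t : ℝ | ⌊(n : ℝ) * t⌋ = k} := by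
      have : Measurable fun t : ℝ => ⌊(n : ℝ) * t⌋ := by fun_prop
      exact this (measurableSet_singleton k)
    refine ((hG (f (k / n))).mono_measure Measure.restrict_le_self).congr ?_
    filter_upwards [ae_restrict_mem hk] with t (ht : ⌊(n : ℝ) * t⌋ = k)
    simp only [p, ht]
  · filter_upwards [hL] with t ht
    rw [tendsto_iff_norm_sub_tendsto_zero]
    have h := ((hf.tendsto t).comp (hp t))
    rw [tendsto_iff_norm_sub_tendsto_zero] at h
    have h' := h.const_mul L
    rw [mul_zero] at h'
    exact squeeze_zero (fun _ => norm_nonneg _) (fun n => ht _ (hfS _) _ (hfS _)) h'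

end Caratheodory

/-! ### Equivalence of the Cauchy problem with a Volterra equation -/

section CauchyProblem

variable {X : Type*} [NormedAddCommGroup X] [NormedSpace ℝ X]
variable {a b : ℝ → ℝ} {T M : ℝ}

theorem lipschitzOnWith_integral {g : ℝ → X}
    (hg : IntegrableOn g (Icc 0 T)) (hM : ∀ᵐ s ∂(volume.restrict (Icc 0 T)), ‖g s‖ ≤ M) :
    LipschitzOnWith M.toNNReal (fun t => ∫ s in (0 : ℝ)..t, g s) (Icc 0 T) := by
  refine LipschitzOnWith.of_dist_le_mul fun s hs t ht => ?_
  have hi {r : ℝ} (hr : r ∈ Icc 0 T) : IntervalIntegrable g volume 0 r :=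
    (intervalIntegrable_iff_integrableOn_Icc_of_le hr.1).2 (hg.mono_set (Icc_subset_Icc_right hr.2))
  rw [dist_eq_norm, intervalIntegral.integral_interval_sub_left (hi hs) (hi ht), Real.dist_eq]
  refine intervalIntegral.norm_integral_le_of_norm_le_const_ae ?_
  rw [ae_restrict_iff' measurableSet_Icc] at hM
  filter_upwards [hM] with r hr hr'
  refine (hr ?_).trans (Real.le_coe_toNNReal M)
  rw [uIoc, mem_Ioc] at hr'
  exact ⟨(le_min ht.1 hs.1).trans hr'.1.le, hr'.2.trans (max_le ht.2 hs.2)⟩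

variable [CompleteSpace X]

/-- Differentiability is a hypothesis because absolute continuity alone does not give it in a
general Banach space. Subtracting the primitive of g leaves an absolutely continuous function with
derivative zero almost everywhere, hence a constant. -/
theorem AbsolutelyContinuousOnInterval.eq_add_integral_of_ae_hasDerivAt {w g : ℝ → X}
    (hT : 0 ≤ T) (hw : AbsolutelyContinuousOnInterval w 0 T)
    (hg : AEStronglyMeasurable g (volume.restrict (Icc 0 T)))
    (hM : ∀ᵐ s ∂(volume.restrict (Icc 0 T)), ‖g s‖ ≤ M)
    (hd : ∀ᵐ t ∂(volume.restrict (Icc 0 T)), HasDerivAt w (g t) t) :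
    ∀ t ∈ Icc 0 T, w t = w 0 + ∫ s in (0 : ℝ)..t, g s := by
  have hgint : IntegrableOn g (Icc 0 T) := by
    have : IsFiniteMeasure (volume.restrict (Icc 0 T)) := ⟨by simp⟩
    exact Integrable.of_bound hg M hM
  have hi : IntervalIntegrable g volume 0 T :=
    (intervalIntegrable_iff_integrableOn_Icc_of_le hT).2 hgint
  have hac : AbsolutelyContinuousOnInterval (fun t => ∫ s in (0 : ℝ)..t, g s) 0 T := by
    refine LipschitzOnWith.absolutelyContinuousOnInterval (K := M.toNNReal) ?_
    rw [uIcc_of_le hT]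
    exact lipschitzOnWith_integral hgint hM
  obtain ⟨c, hc⟩ := (hw.sub hac).const_of_ae_hasDerivAt_zero (by
    rw [uIcc_of_le hT, ← ae_restrict_iff' measurableSet_Icc]
    filter_upwards [hd, ae_restrict_of_ae hi.ae_hasDerivAt_integral,
      ae_restrict_mem measurableSet_Icc] with t h1 h2 ht
    rw [uIcc_of_le hT] at h2
    simpa using h1.sub (h2 ht 0 ⟨le_rfl, hT⟩))
  rw [uIcc_of_le hT] at hc
  intro t ht
  have h1 := hc t ht
  have h2 := hc 0 ⟨le_rfl, hT⟩
  simp only [Pi.sub_apply, intervalIntegral.integral_same, sub_zero] at h1 h2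
  rw [h2, ← h1]
  abel

theorem eqOn_zero_of_integral_eq_zero {d : ℝ → X} (hT : 0 < T) (hd : ContinuousOn d (Icc 0 T))
    (h : ∀ t ∈ Icc 0 T, ∫ s in (0 : ℝ)..t, d s = 0) : EqOn d 0 (Icc 0 T) := by
  have h1 : EqOn d 0 (Ioo 0 T) := by
    intro t ht
    have hnhds : Icc 0 T ∈ 𝓝 t := Icc_mem_nhds ht.1 ht.2
    have hi : IntervalIntegrable d volume 0 t :=
      (hd.mono (by rw [uIcc_of_le ht.1.le]; exact Icc_subset_Icc_right ht.2.le)).intervalIntegrable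
    have hder := intervalIntegral.integral_hasDerivAt_right hi
      (hd.stronglyMeasurableAtFilter_nhdsWithin measurableSet_Icc t |>.filter_mono
        (by rw [nhdsWithin_eq_nhds.2 hnhds])) (hd.continuousAt hnhds)
    refine hder.unique ((hasDerivAt_const t (0 : X)).congr_of_eventuallyEq ?_)
    filter_upwards [hnhds] with s hs using h s hs
  exact h1.of_subset_closure hd continuousOn_const Ioo_subset_Icc_self
    (by rw [closure_Ioo hT.ne])

/-- A Cauchy problem for the generalized Caputo derivative is equivalent to a Volterra equation. -/
theorem isCauchySolution_iff {ν : Measure ℝ} (ha : IsVolterraKernel a)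
    (hb : IsVolterraKernel fun t => (ν (Ioi t)).toReal)
    (hab : IsSoninePair a fun t => (ν (Ioi t)).toReal) (hT : 0 < T) {G : ℝ → X → X} {f₀ : X}
    {f : C(Icc (0 : ℝ) T, X)}
    (hG : AEStronglyMeasurable (fun t => G t (IccExtend hT.le f t)) (volume.restrict (Icc 0 T)))
    (hM : ∀ᵐ t ∂(volume.restrict (Icc 0 T)), ‖G t (IccExtend hT.le f t)‖ ≤ M) :
    IsCauchySolution ν G f₀ hT.le f ↔ ∀ t ∈ Icc 0 T, IccExtend hT.le f t =
      f₀ + volterra a (fun s => G s (IccExtend hT.le f s)) t := by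
  set φ : ℝ → X := IccExtend hT.le f with hφ
  set g : ℝ → X := fun s => G s (φ s) with hg
  have hφc : Continuous φ := f.continuous.Icc_extend'
  have hφ0 : φ 0 = f ⟨0, left_mem_Icc.2 hT.le⟩ := IccExtend_left hT.le f
  have h0 : (0 : ℝ) ∈ Icc 0 T := ⟨le_rfl, hT.le⟩
  have hgint : IntegrableOn g (Icc 0 T) := by
    have : IsFiniteMeasure (volume.restrict (Icc 0 T)) := ⟨by simp⟩
    exact Integrable.of_bound hG M hM
  have hcomp (t : ℝ) (ht : t ∈ Icc 0 T) :
      volterra (fun t => (ν (Ioi t)).toReal) (volterra a g) t = ∫ s in (0 : ℝ)..t, g s :=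
    volterra_volterra hb ha hab.symm ht.1
      (hgint.mono_set fun s hs => ⟨hs.1.le, hs.2.trans ht.2⟩)
  have hav : ContinuousOn (volterra a g) (Icc 0 T) := continuousOn_volterra ha hG hM
  have hw : caputoPrimitive ν φ = volterra (fun t => (ν (Ioi t)).toReal) fun s => φ s - φ 0 := rfl
  constructor
  · intro hsol
    have hφ0' : φ 0 = f₀ := hφ0.trans hsol.initial
    have hprim (t : ℝ) (ht : t ∈ Icc 0 T) : caputoPrimitive ν φ t = ∫ s in (0 : ℝ)..t, g s := by
      rw [hsol.absolutelyContinuous.eq_add_integral_of_ae_hasDerivAt hT.le hG hM hsol.equation t ht]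
      simp [caputoPrimitive]
    have hd : ContinuousOn (fun s => (φ s - φ 0) - volterra a g s) (Icc 0 T) :=
      (hφc.continuousOn.sub continuousOn_const).sub hav
    -- Both φ - φ(0) and a * g have convolution ∫g with the tail. Convolving their difference with a
    -- then turns this into vanishing integrals.
    have hd0 (t : ℝ) (ht : t ∈ Icc 0 T) : volterra (fun t => (ν (Ioi t)).toReal)
        (fun s => (φ s - φ 0) - volterra a g s) t = 0 := by
      obtain ⟨M₁, hM₁⟩ := isCompact_Icc.exists_bound_of_continuousOn
        (hφc.continuousOn.sub (continuousOn_const (c := φ 0)) : ContinuousOn _ (Icc 0 T))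
      obtain ⟨M₂, hM₂⟩ := isCompact_Icc.exists_bound_of_continuousOn hav
      rw [volterra_sub (M := M₁) (N := M₂) hb ht, ← hw, hprim t ht, hcomp t ht, sub_self]
      · exact (hφc.sub continuous_const).aestronglyMeasurable
      · filter_upwards [ae_restrict_mem measurableSet_Icc] with s hs using hM₁ s hs
      · exact hav.aestronglyMeasurable measurableSet_Icc
      · filter_upwards [ae_restrict_mem measurableSet_Icc] with s hs using hM₂ s hs
    have hzero := eqOn_zero_of_integral_eq_zero hT hd fun t ht => by
      rw [← volterra_volterra ha hb hab ht.1
        ((hd.mono fun s hs => ⟨hs.1, hs.2.trans ht.2⟩).integrableOn_Icc.mono_set Ioc_subset_Icc_self),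
        volterra_congr_ae (g := 0) ht.1]
      · simp [volterra]
      · filter_upwards [ae_restrict_mem measurableSet_Ioo] with s hs
        exact hd0 s ⟨hs.1.le, hs.2.le.trans ht.2⟩
    intro t ht
    have := hzero ht
    simp only [Pi.zero_apply] at this
    rw [← hφ0', ← sub_eq_zero, ← this]
    abel
  · intro h
    have hφ0' : φ 0 = f₀ := by
      rw [h 0 h0]
      simp [volterra]
    have hprim (t : ℝ) (ht : t ∈ Icc 0 T) : caputoPrimitive ν φ t = ∫ s in (0 : ℝ)..t, g s := by
      rw [← hcomp t ht, hw]
      refine volterra_congr_ae ht.1 ?_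
      filter_upwards [ae_restrict_mem measurableSet_Ioo] with s hs
      rw [h s ⟨hs.1.le, hs.2.le.trans ht.2⟩, hφ0']
      abel
    refine ⟨hφ0.symm.trans hφ0', ?_, ?_⟩
    · refine LipschitzOnWith.absolutelyContinuousOnInterval (K := M.toNNReal) ?_
      rw [uIcc_of_le hT.le]
      intro s hs t ht
      rw [hprim s hs, hprim t ht]
      exact lipschitzOnWith_integral hgint hM hs ht
    · have hi : IntervalIntegrable g volume 0 T :=
        (intervalIntegrable_iff_integrableOn_Icc_of_le hT.le).2 hgint
      have hder := hi.ae_hasDerivAt_integral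
      -- The derivative is two-sided, so the identity with ∫g must hold on a neighbourhood of t;
      -- this is available at interior points only.
      rw [← restrict_Ioo_eq_restrict_Icc, ae_restrict_iff' measurableSet_Ioo]
      filter_upwards [hder] with t ht ht'
      refine (ht (by rw [uIcc_of_le hT.le]; exact Ioo_subset_Icc_self ht') 0
        left_mem_uIcc).congr_of_eventuallyEq ?_
      filter_upwards [Icc_mem_nhds ht'.1 ht'.2] with s hs using hprim s hs

end CauchyProblem

/-! ### Existence and stability for Volterra equations -/

section WellPosedness

variable {X : Type*} [NormedAddCommGroup X]
variable {a : ℝ → ℝ} {T C L : ℝ}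

theorem IsVolterraKernel.exp_mul (ha : IsVolterraKernel a) {c : ℝ} (hc : 0 ≤ c) :
    IsVolterraKernel fun s => Real.exp (-(c * s)) * a s where
  nonneg t ht := mul_nonneg (Real.exp_nonneg _) (ha.nonneg t ht)
  antitone s hs t ht hst := by
    have h1 := ha.nonneg t ht
    have h2 := ha.antitone hs ht hst
    dsimp only
    gcongr
  integrableOn t := by
    rcases le_or_gt 0 t with ht | ht
    · exact (intervalIntegrable_iff_integrableOn_Ioc_of_le ht).1
        ((ha.intervalIntegrable le_rfl ht).continuousOn_mul (by fun_prop))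
    · simp [Ioc_eq_empty (not_lt.2 ht.le)]

/-- Dominated convergence with majorant a. It supplies the exponential weight for intervals that
need not be short. -/
theorem IsVolterraKernel.tendsto_integral_exp_mul (ha : IsVolterraKernel a) (hT : 0 ≤ T) :
    Tendsto (fun n : ℕ => ∫ s in (0 : ℝ)..T, Real.exp (-(n * s)) * a s) atTop (𝓝 0) := by
  have hi := ha.intervalIntegrable le_rfl hT
  have h := intervalIntegral.tendsto_integral_filter_of_dominated_convergence
    (F := fun (n : ℕ) s => Real.exp (-(n * s)) * a s) (f := fun _ => 0) (l := atTop)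
    (μ := volume) (a := 0) (b := T) a
    (Eventually.of_forall fun n => ?_) (Eventually.of_forall fun n => ?_) hi ?_
  · simpa using h
  · have h1 : IntervalIntegrable (fun s => Real.exp (-(n * s)) * a s) volume 0 T :=
      hi.continuousOn_mul (by fun_prop)
    exact h1.aestronglyMeasurable_restrict_uIoc
  · refine Eventually.of_forall fun s hs => ?_
    rw [uIoc_of_le hT] at hs
    have h1 := ha.nonneg s hs.1
    rw [norm_mul, Real.norm_of_nonneg h1, Real.norm_of_nonneg (Real.exp_nonneg _)]
    refine mul_le_of_le_one_left h1 (Real.exp_le_one_iff.2 ?_)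
    have := mul_nonneg (Nat.cast_nonneg (α := ℝ) n) hs.1.le
    linarith
  · refine Eventually.of_forall fun s hs => ?_
    rw [uIoc_of_le hT] at hs
    have h1 : Tendsto (fun n : ℕ => (n : ℝ) * s) atTop atTop :=
      tendsto_natCast_atTop_atTop.atTop_mul_const hs.1
    simpa using (Real.tendsto_exp_neg_atTop_nhds_zero.comp h1).mul_const (a s)

/-- Carathéodory functions on `[0, T] × S` that are bounded and uniformly Lipschitz. -/
structure IsCaratheodoryOn (G : ℝ → X → X) (S : Set X) (T C L : ℝ) : Prop where
  measurable : ∀ x, AEStronglyMeasurable (fun t => G t x) (volume.restrict (Icc 0 T))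
  bound : ∀ᵐ t ∂(volume.restrict (Icc 0 T)), ∀ x ∈ S, ‖G t x‖ ≤ C
  lipschitz : ∀ᵐ t ∂(volume.restrict (Icc 0 T)), ∀ x ∈ S, ∀ z ∈ S, ‖G t x - G t z‖ ≤ L * ‖x - z‖

variable {G G₁ G₂ : ℝ → X → X} {S : Set X}

theorem IsCaratheodoryOn.mono {T' : ℝ} (hG : IsCaratheodoryOn G S T C L) (h : T' ≤ T) :
    IsCaratheodoryOn G S T' C L where
  measurable x := (hG.measurable x).mono_measure
    (Measure.restrict_mono (Icc_subset_Icc_right h) le_rfl)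
  bound := ae_restrict_of_ae_restrict_of_subset (Icc_subset_Icc_right h) hG.bound
  lipschitz := ae_restrict_of_ae_restrict_of_subset (Icc_subset_Icc_right h) hG.lipschitz

theorem IsCaratheodoryOn.aestronglyMeasurable_comp (hG : IsCaratheodoryOn G S T C L) (hT : 0 ≤ T)
    {f : C(Icc (0 : ℝ) T, X)} (hf : ∀ t, f t ∈ S) :
    AEStronglyMeasurable (fun t => G t (IccExtend hT f t)) (volume.restrict (Icc 0 T)) :=
  aestronglyMeasurable_comp_of_lipschitz hG.measurable hG.lipschitz f.continuous.Icc_extend'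
    fun _ => hf _

theorem IsCaratheodoryOn.norm_comp_le (hG : IsCaratheodoryOn G S T C L) (hT : 0 ≤ T)
    {f : C(Icc (0 : ℝ) T, X)} (hf : ∀ t, f t ∈ S) :
    ∀ᵐ t ∂(volume.restrict (Icc 0 T)), ‖G t (IccExtend hT f t)‖ ≤ C := by
  filter_upwards [hG.bound] with t ht using ht _ (hf _)

variable [NormedSpace ℝ X]

/-- Stability of Volterra equations, by a weighted supremum norm. -/
theorem dist_le_of_volterra_eq (ha : IsVolterraKernel a) (hT : 0 ≤ T) (hL : 0 < L) {c : ℝ}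
    (hc : 0 ≤ c) (hcL : L * ∫ s in (0 : ℝ)..T, Real.exp (-(c * s)) * a s ≤ 1 / 2)
    (hG₁ : IsCaratheodoryOn G₁ S T C L) (hG₂ : IsCaratheodoryOn G₂ S T C L) {δ : ℝ}
    (hδ0 : 0 ≤ δ)
    (hδ : ∀ᵐ t ∂(volume.restrict (Icc 0 T)), ∀ x ∈ S, ‖G₁ t x - G₂ t x‖ ≤ δ) {f₀ : X}
    {f₁ f₂ : C(Icc (0 : ℝ) T, X)} (hf₁ : ∀ t, f₁ t ∈ S) (hf₂ : ∀ t, f₂ t ∈ S)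
    (h₁ : ∀ t ∈ Icc 0 T, IccExtend hT f₁ t =
      f₀ + volterra a (fun s => G₁ s (IccExtend hT f₁ s)) t)
    (h₂ : ∀ t ∈ Icc 0 T, IccExtend hT f₂ t =
      f₀ + volterra a (fun s => G₂ s (IccExtend hT f₂ s)) t) :
    dist f₁ f₂ ≤ Real.exp (c * T) / L * δ := by
  set φ₁ : ℝ → X := IccExtend hT f₁
  set φ₂ : ℝ → X := IccExtend hT f₂
  have hφ₁ : Continuous φ₁ := f₁.continuous.Icc_extend'
  have hφ₂ : Continuous φ₂ := f₂.continuous.Icc_extend'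
  -- N is the weighted supremum distance, attained at t; estimating the equation there bounds N by
  -- itself.
  obtain ⟨t, ht, hmax⟩ := isCompact_Icc.exists_isMaxOn (nonempty_Icc.2 hT)
    (f := fun t => Real.exp (-(c * t)) * ‖φ₁ t - φ₂ t‖) (by fun_prop)
  set N : ℝ := Real.exp (-(c * t)) * ‖φ₁ t - φ₂ t‖ with hN
  have hN0 : 0 ≤ N := by positivity
  have hle (s : ℝ) (hs : s ∈ Icc 0 T) : ‖φ₁ s - φ₂ s‖ ≤ N * Real.exp (c * s) := by
    have h := mul_le_mul_of_nonneg_right (isMaxOn_iff.1 hmax s hs) (Real.exp_nonneg (c * s))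
    rwa [mul_right_comm, ← Real.exp_add, neg_add_cancel, Real.exp_zero, one_mul] at h
  have hdiff : φ₁ t - φ₂ t = volterra a (fun s => G₁ s (φ₁ s) - G₂ s (φ₂ s)) t := by
    rw [volterra_sub ha ht (hG₁.aestronglyMeasurable_comp hT hf₁) (hG₁.norm_comp_le hT hf₁)
      (hG₂.aestronglyMeasurable_comp hT hf₂) (hG₂.norm_comp_le hT hf₂), h₁ t ht, h₂ t ht]
    abel
  have hbound : ∀ᵐ s ∂(volume.restrict (Ioc 0 t)),
      ‖G₁ s (φ₁ s) - G₂ s (φ₂ s)‖ ≤ (L * N + δ) * Real.exp (c * s) := by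
    filter_upwards [ae_restrict_Ioc_of_Icc ht.2 hG₁.lipschitz, ae_restrict_Ioc_of_Icc ht.2 hδ,
      ae_restrict_mem measurableSet_Ioc] with s h1 h2 hs
    have e1 := h1 (φ₁ s) (hf₁ _) (φ₂ s) (hf₂ _)
    have e2 := h2 (φ₂ s) (hf₂ _)
    have e3 := hle s ⟨hs.1.le, hs.2.trans ht.2⟩
    have e4 : (1 : ℝ) ≤ Real.exp (c * s) := Real.one_le_exp (mul_nonneg hc hs.1.le)
    calc ‖G₁ s (φ₁ s) - G₂ s (φ₂ s)‖
        ≤ ‖G₁ s (φ₁ s) - G₁ s (φ₂ s)‖ + ‖G₁ s (φ₂ s) - G₂ s (φ₂ s)‖ :=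
          norm_sub_le_norm_sub_add_norm_sub _ _ _
      _ ≤ L * (N * Real.exp (c * s)) + δ * Real.exp (c * s) := by
          refine add_le_add (e1.trans (by gcongr)) (e2.trans (le_mul_of_one_le_right hδ0 e4))
      _ = _ := by ring
  have hest := norm_volterra_le_exp ha ht.1 hbound
  rw [← hdiff] at hest
  have hmono := (ha.exp_mul hc).integral_mono ht.1 ht.2
  -- The choice of c gives L N ≤ (L N + δ)/2, and the term with N is absorbed on the left.
  have hNle : N ≤ δ / L := by
    have h1 : N ≤ (L * N + δ) * ∫ s in (0 : ℝ)..T, Real.exp (-(c * s)) * a s := by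
      calc N ≤ Real.exp (-(c * t)) * ((L * N + δ) * Real.exp (c * t) *
            ∫ s in (0 : ℝ)..t, Real.exp (-(c * s)) * a s) := by rw [hN]; gcongr
        _ = (Real.exp (-(c * t)) * Real.exp (c * t)) * ((L * N + δ) *
            ∫ s in (0 : ℝ)..t, Real.exp (-(c * s)) * a s) := by ring
        _ = (L * N + δ) * ∫ s in (0 : ℝ)..t, Real.exp (-(c * s)) * a s := by
            rw [← Real.exp_add, neg_add_cancel, Real.exp_zero, one_mul]
        _ ≤ _ := by gcongr
    have h2 : (L * N + δ) * (L * ∫ s in (0 : ℝ)..T, Real.exp (-(c * s)) * a s) ≤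
        (L * N + δ) * (1 / 2) := by gcongr
    have h3 : L * N ≤ (L * N + δ) * (L * ∫ s in (0 : ℝ)..T, Real.exp (-(c * s)) * a s) := by
      calc L * N ≤ L * ((L * N + δ) * ∫ s in (0 : ℝ)..T, Real.exp (-(c * s)) * a s) := by gcongr
        _ = _ := by ring
    rw [le_div_iff₀ hL]
    linarith
  rw [ContinuousMap.dist_le (by positivity)]
  intro x
  have h := hle x x.2
  simp only [φ₁, φ₂, IccExtend_val] at h
  rw [dist_eq_norm]
  refine h.trans ?_
  have hx : Real.exp (c * x) ≤ Real.exp (c * T) := by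
    have := x.2.2
    gcongr
  calc N * Real.exp (c * x) ≤ δ / L * Real.exp (c * T) := by gcongr
    _ = _ := by ring

/-- Local existence for Volterra equations, by the contraction principle. -/
theorem exists_volterra_eq [CompleteSpace X] (ha : IsVolterraKernel a) (hT : 0 ≤ T) {f₀ : X}
    {R : ℝ} (hR : 0 < R) (hC : 0 ≤ C) (hL : 0 ≤ L)
    (hG : IsCaratheodoryOn G (Metric.ball f₀ R) T C L)
    (hCa : C * ∫ s in (0 : ℝ)..T, a s ≤ R / 2) (hLa : L * ∫ s in (0 : ℝ)..T, a s ≤ 1 / 2) :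
    ∃ f : C(Icc (0 : ℝ) T, X), (∀ t, f t ∈ Metric.ball f₀ R) ∧ ∀ t ∈ Icc 0 T,
      IccExtend hT f t = f₀ + volterra a (fun s => G s (IccExtend hT f s)) t := by
  -- The closed ball of half the radius is complete and still lies in the open ball where G is
  -- controlled.
  let B : Set C(Icc (0 : ℝ) T, X) := {f | ∀ t, f t ∈ Metric.closedBall f₀ (R / 2)}
  have hB (f : B) (t) : f.1 t ∈ Metric.ball f₀ R :=
    Metric.closedBall_subset_ball (by linarith) (f.2 t)
  have hBc : IsClosed B := by
    simp only [B, ofPred_forall]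
    exact isClosed_iInter fun t => Metric.isClosed_closedBall.preimage
      (continuous_eval_const t)
  have : CompleteSpace B := hBc.completeSpace_coe
  have : Nonempty B := ⟨⟨ContinuousMap.const _ f₀, fun t => by simp; linarith⟩⟩
  have hmap (f : B) : ∃ g : B, ∀ t : Icc (0 : ℝ) T,
      g.1 t = f₀ + volterra a (fun s => G s (IccExtend hT f.1 s)) t := by
    have hc := continuousOn_volterra ha (hG.aestronglyMeasurable_comp hT (hB f))
      (hG.norm_comp_le hT (hB f))
    refine ⟨⟨⟨fun t => f₀ + volterra a (fun s => G s (IccExtend hT f.1 s)) t, ?_⟩,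
      fun t => ?_⟩, fun t => rfl⟩
    · exact continuous_const.add (continuousOn_iff_continuous_domRestrict.1 hc)
    · simp only [ContinuousMap.coe_mk, Metric.mem_closedBall, dist_self_add_left]
      refine (norm_volterra_le ha t.2.1
        (ae_restrict_Ioc_of_Icc t.2.2 (hG.norm_comp_le hT (hB f)))).trans (le_trans ?_ hCa)
      have := ha.integral_mono t.2.1 t.2.2
      gcongr
  choose Λ hΛ using hmap
  have hcontr : ContractingWith (1 / 2) Λ := by
    refine ⟨by norm_num, LipschitzWith.of_dist_le_mul fun f g => ?_⟩
    rw [Subtype.dist_eq, Subtype.dist_eq, ContinuousMap.dist_le (by positivity)]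
    intro t
    rw [hΛ, hΛ, dist_add_left, dist_eq_norm,
      ← volterra_sub ha t.2 (hG.aestronglyMeasurable_comp hT (hB f)) (hG.norm_comp_le hT (hB f))
        (hG.aestronglyMeasurable_comp hT (hB g)) (hG.norm_comp_le hT (hB g))]
    have hb : ∀ᵐ s ∂(volume.restrict (Ioc 0 (t : ℝ))),
        ‖G s (IccExtend hT f.1 s) - G s (IccExtend hT g.1 s)‖ ≤ L * dist f.1 g.1 := by
      filter_upwards [ae_restrict_Ioc_of_Icc t.2.2 hG.lipschitz] with s hs
      refine (hs _ (hB f _) _ (hB g _)).trans ?_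
      rw [← dist_eq_norm]
      gcongr
      exact ContinuousMap.dist_apply_le_dist _
    refine (norm_volterra_le ha t.2.1 hb).trans ?_
    have := ha.integral_mono t.2.1 t.2.2
    calc L * dist f.1 g.1 * ∫ s in (0 : ℝ)..t, a s
        ≤ L * dist f.1 g.1 * ∫ s in (0 : ℝ)..T, a s := by gcongr
      _ = (L * ∫ s in (0 : ℝ)..T, a s) * dist f.1 g.1 := by ring
      _ ≤ 1 / 2 * dist f.1 g.1 := by gcongr
      _ = _ := by simp
  refine ⟨(ContractingWith.fixedPoint Λ hcontr).1, hB _, fun t ht => ?_⟩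
  have hfix := hcontr.fixedPoint_isFixedPt
  rw [IccExtend_of_mem _ _ ht]
  nth_rewrite 1 [← hfix]
  exact hΛ _ ⟨t, ht⟩

end WellPosedness

/-! ### The proposition -/

theorem proposition6p4
    {Ω : Type*} [MeasurableSpace Ω] (P : Measure Ω) [IsProbabilityMeasure P]
    {X : Type*} [NormedAddCommGroup X] [NormedSpace ℝ X] [CompleteSpace X]
    {V : Type*} [MetricSpace V] [LocallyCompactSpace V]
    -- a special Bernstein function without killing and drift, with infinite Lévy measure
    (Φ : ℝ → ℝ) (hΦ : IsSpecialBernstein Φ)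
    (ν : Measure ℝ) (hν : HasLevyTriple Φ 0 0 ν) (hν_infinite : ν (Ioi 0) = ∞)
    -- its subordinator and its potential density
    (σ : ℝ≥0 → Ω → ℝ) (hσ : IsSubordinator σ P) (hσΦ : HasLaplaceExponent σ P Φ)
    (u : ℝ → ℝ) (hu : IsPotentialDensity σ P u)
    (hu_bound : ∃ t₀ > (0 : ℝ), ∃ C > (0 : ℝ), ∃ β ∈ Ioo (0 : ℝ) 1,
      ∀ t ∈ Ioo (0 : ℝ) t₀, u t ≤ C * t ^ (β - 1))
    -- the right-hand side
    (T : ℝ) (hT : 0 < T) (F : ℝ → X → V → X)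
    (hF_meas : ∀ (x : X) (v : V),
      AEStronglyMeasurable (fun t => F t x v) (volume.restrict (Icc (0 : ℝ) T)))
    (hA1 : ∀ K : Set V, IsCompact K → ∀ r : ℝ, 0 < r → ∃ C > (0 : ℝ),
      ∀ᵐ t ∂(volume.restrict (Icc (0 : ℝ) T)), ∀ x ∈ Metric.ball (0 : X) r, ∀ v ∈ K,
        ‖F t x v‖ ≤ C)
    (hA2 : ∀ K : Set V, IsCompact K → ∀ r : ℝ, 0 < r → ∃ L > (0 : ℝ),
      ∀ᵐ t ∂(volume.restrict (Icc (0 : ℝ) T)),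
        ∀ x ∈ Metric.ball (0 : X) r, ∀ z ∈ Metric.ball (0 : X) r, ∀ v ∈ K,
          ‖F t x v - F t z v‖ ≤ L * ‖x - z‖)
    (hA3 : ∀ K : Set V, IsCompact K → ∀ r : ℝ, 0 < r → ∃ L > (0 : ℝ),
      ∀ᵐ t ∂(volume.restrict (Icc (0 : ℝ) T)),
        ∀ x ∈ Metric.ball (0 : X) r, ∀ v₁ ∈ K, ∀ v₂ ∈ K,
          ‖F t x v₁ - F t x v₂‖ ≤ L * dist v₁ v₂)
    (f₀ : X) (v₀ : V) (R : ℝ) (hR : 0 < R) :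
    -- a common interval and a compact neighbourhood with unique solvability
    (∃ T' : ℝ, ∃ hT' : 0 < T', T' ≤ T ∧ ∃ K : Set V, IsCompact K ∧ K ∈ 𝓝 v₀ ∧
      ∀ v ∈ K, ∃! f : C(Icc (0 : ℝ) T', X),
        IsCauchySolution ν (fun t x => F t x v) f₀ hT'.le f ∧ ∀ t, f t ∈ Metric.ball f₀ R) ∧
    -- on every such interval and neighbourhood the solution map is continuous at `v₀`,
    -- and Lipschitz on the neighbourhood
    (∀ T' : ℝ, ∀ hT' : 0 < T', T' ≤ T → ∀ K : Set V, IsCompact K → ∀ hK : K ∈ 𝓝 v₀,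
      ∀ Ψ : K → C(Icc (0 : ℝ) T', X),
        (∀ v : K, IsCauchySolution ν (fun t x => F t x (v : V)) f₀ hT'.le (Ψ v) ∧
          ∀ t, Ψ v t ∈ Metric.ball f₀ R) →
        ContinuousAt Ψ ⟨v₀, mem_of_mem_nhds hK⟩ ∧ ∃ L : ℝ≥0, LipschitzWith L Ψ) := by
  have ha : IsVolterraKernel u := hu.isVolterraKernel hσ hσΦ hΦ.pos
  have hb : IsVolterraKernel fun t => (ν (Ioi t)).toReal := hν.isVolterraKernel_tail
  have hab : IsSoninePair u fun t => (ν (Ioi t)).toReal := hu.isSoninePair hσ hσΦ hΦ.pos hν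
  have hball : Metric.ball f₀ R ⊆ Metric.ball (0 : X) (R + ‖f₀‖) :=
    Metric.ball_subset_ball' (by rw [dist_zero_right])
  have hr : 0 < R + ‖f₀‖ := by positivity
  have hcar (K : Set V) (hK : IsCompact K) : ∃ C > 0, ∃ L > 0, ∀ v ∈ K,
      IsCaratheodoryOn (fun t x => F t x v) (Metric.ball f₀ R) T C L := by
    obtain ⟨C, hC, h1⟩ := hA1 K hK _ hr
    obtain ⟨L, hL, h2⟩ := hA2 K hK _ hr
    refine ⟨C, hC, L, hL, fun v hv => ⟨fun x => hF_meas x v, ?_, ?_⟩⟩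
    · filter_upwards [h1] with t ht x hx using ht x (hball hx) v hv
    · filter_upwards [h2] with t ht x hx z hz using ht x (hball hx) z (hball hz) v hv
  have hweight (L T' : ℝ) (hT' : 0 ≤ T') : ∃ c : ℝ, 0 ≤ c ∧
      L * ∫ s in (0 : ℝ)..T', Real.exp (-(c * s)) * u s ≤ 1 / 2 := by
    have h := (ha.tendsto_integral_exp_mul hT').const_mul L
    rw [mul_zero] at h
    obtain ⟨n, hn⟩ := (h.eventually_le_const (u := 1 / 2) (by norm_num)).exists
    exact ⟨n, n.cast_nonneg, hn⟩
  have hiff {T' C L : ℝ} (hT' : 0 < T') {v : V}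
      (hG : IsCaratheodoryOn (fun t x => F t x v) (Metric.ball f₀ R) T' C L)
      {f : C(Icc (0 : ℝ) T', X)} (hf : ∀ t, f t ∈ Metric.ball f₀ R) :=
    isCauchySolution_iff ha hb hab hT' (G := fun t x => F t x v) (f₀ := f₀) (f := f)
      (hG.aestronglyMeasurable_comp hT'.le hf)
      (hG.norm_comp_le hT'.le hf)
  refine ⟨?_, ?_⟩
  · obtain ⟨K, hKc, hKn⟩ := exists_compact_mem_nhds v₀
    obtain ⟨C, hC, L, hL, hG⟩ := hcar K hKc
    have h1 := ha.tendsto_integral.const_mul C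
    have h2 := ha.tendsto_integral.const_mul L
    rw [mul_zero] at h1 h2
    -- Passing to the punctured right neighbourhood of 0 makes T' strictly positive.
    have h3 := (h1.eventually_le_const (half_pos hR)).filter_mono
      (nhdsWithin_mono 0 Ioi_subset_Ici_self)
    have h4 := (h2.eventually_le_const (u := 1 / 2) (by norm_num)).filter_mono
      (nhdsWithin_mono 0 Ioi_subset_Ici_self)
    obtain ⟨T', ⟨hCT, hLT⟩, hT', hT'T⟩ :=
      ((h3.and h4).and (Ioc_mem_nhdsGT hT)).exists
    refine ⟨T', hT', hT'T, K, hKc, hKn, fun v hv => ?_⟩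
    have hGv := (hG v hv).mono hT'T
    obtain ⟨f, hfB, hf⟩ := exists_volterra_eq ha hT'.le hR hC.le hL.le hGv hCT hLT
    refine ⟨f, ⟨(hiff hT' hGv hfB).2 hf, hfB⟩, fun g ⟨hg, hgB⟩ => ?_⟩
    -- The contraction gives uniqueness only in the ball of radius R/2. Stability with δ = 0 covers
    -- all solutions with values in the ball of radius R.
    obtain ⟨c, hc, hcL⟩ := hweight L T' hT'.le
    have h := dist_le_of_volterra_eq ha hT'.le hL hc hcL hGv hGv le_rfl
      (Eventually.of_forall fun t x _ => by simp) hgB hfB ((hiff hT' hGv hgB).1 hg) hf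
    rw [mul_zero] at h
    exact dist_le_zero.1 h
  · intro T' hT' hT'T K hKc hKn Ψ hΨ
    obtain ⟨C, hC, L, hL, hG⟩ := hcar K hKc
    obtain ⟨L', hL', h3⟩ := hA3 K hKc _ hr
    obtain ⟨c, hc, hcL⟩ := hweight L T' hT'.le
    -- This is the stability estimate with δ = L' d(v, w), supplied by (A3′); c depends on K and T'
    -- but not on v and w.
    have hlip : LipschitzWith (Real.exp (c * T') / L * L').toNNReal Ψ := by
      refine LipschitzWith.of_dist_le_mul fun v w => ?_
      rw [Real.coe_toNNReal _ (by positivity), mul_assoc]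
      have hGv := (hG v v.2).mono hT'T
      have hGw := (hG w w.2).mono hT'T
      refine dist_le_of_volterra_eq ha hT'.le hL hc hcL hGv hGw (by positivity) ?_ (hΨ v).2
        (hΨ w).2 ((hiff hT' hGv (hΨ v).2).1 (hΨ v).1) ((hiff hT' hGw (hΨ w).2).1 (hΨ w).1)
      filter_upwards [ae_restrict_of_ae_restrict_of_subset (Icc_subset_Icc_right hT'T) h3]
        with t ht x hx
      exact ht x (hball hx) v v.2 w w.2
    exact ⟨hlip.continuous.continuousAt, _, hlip⟩
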